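/- Let $\mathbb T=\mathbb R\cup\{-\infty\}$ with $x\oplus y=\max(x,y)$, $x\otimes y=x+y$, $x\oslash y=x-y$, $1_{\mathbb T}=0$. Let $\mathbb{TP}=(\mathbb T^2\setminus\{(-\infty,-\infty)\})/\!\sim$ be the tropical projective line, identified with $\mathbb R\cup\{\pm\infty\}$ via $[x_0:x_1]\mapsto x_1\oslash x_0$. A *tropical entire function* on $\mathbb R^n$ is a function $g(x)=\bigoplus_{i=0}^{\infty}a_i\otimes x^{\otimes \mathbf m_i}=\max_{i}\{a_i+\langle \mathbf m_i,x\rangle\}$ with $a_i\in\mathbb T$, $\mathbf m_i\in\mathbb R^n$, the maximum being attained at every $x$. *Means and counting functions.* Let $\sigma$ be the surface measure on the unit sphere $S^{n-1}(1)$ and $\omega_n=\sigma(S^{n-1}(1))$. For $h:\mathbb R^n\to\mathbb R$ put $\partial^+_\varphi h(x)=\lim_{s\to0^+}\frac{h(x+s\varphi)-h(x)}{s}$ and $J_h(x;\varphi)=\partial^+_\varphi h(x)+\partial^+_{-\varphi}h(x)$, and for $\theta\in S^{n-1}(1)$ put $h_\theta(s)=h(s\theta)$, $s\in\mathbb R$.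 The counting function of poles is $$N(r,h)=\frac12\int_0^r n(t,h)\,dt,\qquad n(t,h)=\frac1{\omega_n}\int_{S^{n-1}(1)}\ \sum_{|s|<t,\ J_{h_\theta}(s;1)<0}|J_{h_\theta}(s;1)|\,d\sigma(\theta),$$ so that for a tropical entire function $g\not\equiv-\infty$ the function $N(r,\frac{1_{\mathbb T}}{g}\oslash)=N(r,-g)$ counts the roots of $g$. *Statement.* Let $f:\mathbb R^n\to\mathbb{TP}$ be a nonconstant tropical meromorphic function, $f=[f_0:f_1]=f_1\oslash f_0$ with $f_0,f_1$ tropical entire (any such representation is allowed, in particular one in which $f_0$ and $f_1$ have no common roots), and let $$T_f(r)=\frac1{\omega_n}\int_{S^{n-1}(1)}\max\{f_0(r\theta),f_1(r\theta)\}\,d\sigma(\theta)-\max\{f_0(0),f_1(0)\}.$$ Assume $\limsup_{r\to\infty}\frac{\log T_f(r)}{r}=0$. Let $q\ge2$, let $a_j=[a_{j1}:a_{j0}]\in\mathbb{TP}$ $(j=1,\dots,q)$ be distinct, and let $P_j(x_0,x_1)=a_{j0}\otimes x_0\oplus a_{j1}\otimes x_1$, so that $P_j\circ f=(a_{j0}\otimes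 f_0)\oplus(a_{j1}\otimes f_1)$. Suppose that $f\not\equiv f\oplus a_j$ and $f\oplus a_j\not\equiv a_j$ for every $j=1,\dots,q$. Let $c\in\mathbb R^n\setminus\{0\}$, and let $$C_o(g_0,g_1)(x)=\big(g_0(x)\otimes g_1(x+c)\big)\oplus\big(g_0(x+c)\otimes g_1(x)\big)$$ be the tropical Casorati determinant with step $c$. Then $$\begin{aligned}(q-2)T_f(r)&=\sum_{j=1}^{q}N\Big(r,\frac{1_{\mathbb T}}{P_j\circ f}\oslash\Big)-N\Big(r,\frac{1_{\mathbb T}}{C_o(P_1\circ f,P_2\circ f)}\oslash\Big)+o(T_f(r))\\&=\sum_{j=3}^{q}N\Big(r,\frac{1_{\mathbb T}}{P_j\circ f}\oslash\Big)+o(T_f(r))\end{aligned}$$ as $r\to\infty$ outside an exceptional set $E$ of zero upper density, i.e. $\limsup_{r\to\infty}\frac1r\int_{E\cap[1,r]}dt=0$. -/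

import Mathlib

open MeasureTheory Filter Topology Asymptotics

noncomputable section

namespace TropNevanlinna

/-- Euclidean space `ℝⁿ`. -/
abbrev Space (n : ℕ) : Type := EuclideanSpace ℝ (Fin n)

/-- The tropical numbers `𝕋 = ℝ ∪ {-∞}`. Tropical addition `⊕` is `⊔` (maximum), tropical
multiplication `⊗` is `+` (with `⊥` absorbing), `0_𝕋 = ⊥`, `1_𝕋 = 0`. -/
abbrev Trop : Type := WithBot ℝ

/-- The real value of a tropical number (only meaningful when the number is not `-∞`). -/
def Trop.toReal (x : Trop) : ℝ := x.unbotD 0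

/-- The inclusion `𝕋 ⊆ ℝ ∪ {±∞}`. -/
def Trop.toEReal (x : Trop) : EReal := x.recBotCoe ⊥ (fun t : ℝ => (t : EReal))

/-- The tropical projective line `𝕋ℙ = 𝕋ℙ¹`, the completed semiring `ℝ ∪ {±∞}`, in which
`⊕` is the maximum. -/
abbrev ProjLine : Type := EReal

/-- The point `[x₀ : x₁]` of the tropical projective line, identified with the element
`x₁ ⊘ x₀ = x₁ - x₀` of `ℝ ∪ {±∞}` (for `(x₀, x₁) ≠ (-∞, -∞)`). -/
def ProjLine.mk (x₀ x₁ : Trop) : ProjLine := x₁.toEReal - x₀.toEReal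

/-- Tropical entire functions on `ℝⁿ`: functions of the form
`x ↦ ⨁_{i ∈ ℕ} a i ⊗ x^{⊗ m i} = max_i (a i + ⟨m i, x⟩)` with coefficients `a i ∈ 𝕋` and
exponents `m i ∈ ℝⁿ`. The maximum is a genuine one: it is attained at every point. -/
def IsEntire {n : ℕ} (g : Space n → Trop) : Prop :=
  ∃ (a : ℕ → Trop) (m : ℕ → Space n), ∀ x : Space n,
    IsGreatest (Set.range fun i => a i + ((inner ℝ (m i) x : ℝ) : Trop)) (g x)

/-- The positive directional derivative `∂_φ⁺ f(x) = lim_{h → 0⁺} (f (x + h φ) - f x) / h`. -/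
def posDirDeriv {E : Type*} [AddCommGroup E] [Module ℝ E] (f : E → ℝ) (φ x : E) : ℝ :=
  derivWithin (fun h : ℝ => f (x + h • φ)) (Set.Ioi 0) 0

/-- `J_f(x; φ) = ∂_φ⁺ f(x) + ∂_{-φ}⁺ f(x)`. -/
def jump {E : Type*} [AddCommGroup E] [Module ℝ E] (f : E → ℝ) (x φ : E) : ℝ :=
  posDirDeriv f φ x + posDirDeriv f (-φ) x

/-- `n(t, u)` for a function `u` of one real variable: the number of poles of `u` in `(-t, t)`,
i.e. of the points `s` with `J_u(s; 1) < 0`, counted with multiplicity `|J_u(s; 1)|`. -/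
def poleCountLine (t : ℝ) (u : ℝ → ℝ) : ℝ :=
  ∑' s : {s : ℝ // |s| < t ∧ jump u s 1 < 0}, |jump u (s : ℝ) 1|

/-- The mean `(1 / ω_n) ∫_{S^{n-1}(1)} F dσ` over the unit sphere of `ℝⁿ` with respect to the
surface measure `σ`, where `ω_n = σ(S^{n-1}(1))`. For `n = 1`, `σ` is the counting
measure on `{-1, 1}`. -/
def sphereMean (n : ℕ) (F : Space n → ℝ) : ℝ :=
  ⨍ θ : Metric.sphere (0 : Space n) 1, F θ ∂(volume : Measure (Space n)).toSphere

/-- `n(t, f)`: the mean over all directions `θ` of `n(t, f_θ)`, where `f_θ(s) = f(s θ)`. -/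
def poleCount {n : ℕ} (t : ℝ) (f : Space n → ℝ) : ℝ :=
  sphereMean n fun θ => poleCountLine t fun s : ℝ => f (s • θ)

/-- The counting function `N(r, f) = (1/2) ∫_0^r n(t, f) dt` of the poles of `f`. -/
def counting {n : ℕ} (r : ℝ) (f : Space n → ℝ) : ℝ :=
  (1 / 2) * ∫ t in (0 : ℝ)..r, poleCount t f

/-- The counting function `N(r, 1_𝕋 ⊘ g)` of the roots of `g`. -/
def rootCounting {n : ℕ} (r : ℝ) (g : Space n → Trop) : ℝ :=
  counting r fun x => -(g x).toReal

/-- Tropical Cartan characteristic of `[f₀ : f₁]`: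
`T_f(r) = (1 / ω_n) ∫_{S^{n-1}(1)} max (f₀(r θ), f₁(r θ)) dσ(θ) - max (f₀(0), f₁(0))`. -/
def cartanChar {n : ℕ} (f₀ f₁ : Space n → Trop) (r : ℝ) : ℝ :=
  sphereMean n (fun θ => (f₀ (r • θ) ⊔ f₁ (r • θ)).toReal) - (f₀ 0 ⊔ f₁ 0).toReal

/-- Subnormal growth: `limsup_{r → ∞} (log T(r)) / r = 0` (a limsup in `[-∞, ∞]`). -/
def SubnormalGrowth (T : ℝ → ℝ) : Prop :=
  limsup (fun r : ℝ => ((Real.log (T r) / r : ℝ) : EReal)) atTop = 0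

/-- The composition `P ∘ f = a₀ ⊗ f₀ ⊕ a₁ ⊗ f₁` of the tropical linear polynomial
`P(x₀, x₁) = a₀ ⊗ x₀ ⊕ a₁ ⊗ x₁` with `(f₀, f₁)`. -/
def linComp {n : ℕ} (a₀ a₁ : Trop) (f₀ f₁ : Space n → Trop) (x : Space n) : Trop :=
  (a₀ + f₀ x) ⊔ (a₁ + f₁ x)

/-- The tropical Casorati determinant with step `c`:
`C_o(g_0, …, g_{k-1})(x) = ⨁_π g_0(x + π(0) c) ⊗ ⋯ ⊗ g_{k-1}(x + π(k-1) c)`, the tropical sum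
being over all permutations `π` of `{0, …, k-1}`. -/
def casorati {n k : ℕ} (c : Space n) (g : Fin k → Space n → Trop) (x : Space n) : Trop :=
  Finset.univ.sup fun π : Equiv.Perm (Fin k) => ∑ i, g i (x + ((π i : ℕ) : ℝ) • c)

/-- `limsup_{r → ∞} (1/r) |E ∩ [1, r]| = 0`. -/
def ZeroUpperDensity (E : Set ℝ) : Prop :=
  limsup (fun r : ℝ => volume (E ∩ Set.Icc 1 r) / ENNReal.ofReal r) atTop = 0

end TropNevanlinna

end

open MeasureTheory Filter Topology Asymptotics

noncomputable section

namespace TropNevanlinna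

/-! Let `h = max f₀ f₁`. The conditions on `f ⊕ a_j` exclude `a_j = ±∞`, so both coefficients of
each `P_j` are real and `P_j ∘ f` stays within a bounded distance of `h`. Jensen's formula
(`counting_neg`) says that the root counting function of a real-valued tropical entire `g` is its
mean over the sphere of radius `r` minus `g 0`. Hence each `P_j ∘ f` contributes `T_f(r) + O(1)`,
and `O(1)` is `o(T_f)`: since `f` is nonconstant, `h` is not affine, and convexity makes `T_f` grow
at least linearly. This already gives the second equality.

The first equality amounts to the Casoratian contributing `2 T_f + o(T_f)`. It lies within a bounded
distance of `h(x) + h(x + c)`, so what is needed is that translating the sphere by `c` changes the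
mean of `h` by `o(T_f)`. After subtraction of a supporting affine function at `0`, `h` becomes a
convex `g ≥ 0` with `g 0 = 0` and the same characteristic. Convexity gives `g(x + v) - g(x) ≤ g(x +
L v) / L`; the mean of the right side is at most a constant times `T_f(r + L ‖v‖) / L`. Subnormal
growth makes this `O(T_f(r) / L)` off a set of zero upper density, and `L` is arbitrary. Midpoint
convexity turns the upper bound into a two-sided one.

Jensen's formula is proved on lines through `0`. The slope of a convex function could also increase
without kinks, but a tropical entire function has only countably many slopes at points of
differentiability, so its kinks account for the whole increase of slope up to a null set. -/

/-! ### Convex functions of one real variable -/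

section Line

variable {u : ℝ → ℝ}

/-- The right derivative of a function of one real variable. -/
abbrev rightSlope (u : ℝ → ℝ) (s : ℝ) : ℝ := derivWithin u (Set.Ioi s) s

/-- The left derivative of a function of one real variable. -/
abbrev leftSlope (u : ℝ → ℝ) (s : ℝ) : ℝ := derivWithin u (Set.Iio s) s

theorem hasDerivWithinAt_rightSlope (hu : ConvexOn ℝ Set.univ u) (s : ℝ) :
    HasDerivWithinAt u (rightSlope u s) (Set.Ioi s) s :=
  hu.hasDerivWithinAt_rightDeriv_of_mem_interior (by simp)

theorem hasDerivWithinAt_leftSlope (hu : ConvexOn ℝ Set.univ u) (s : ℝ) :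
    HasDerivWithinAt u (leftSlope u s) (Set.Iio s) s :=
  hu.hasDerivWithinAt_leftDeriv_of_mem_interior (by simp)

theorem leftSlope_le_rightSlope (hu : ConvexOn ℝ Set.univ u) (s : ℝ) :
    leftSlope u s ≤ rightSlope u s :=
  hu.leftDeriv_le_rightDeriv_of_mem_interior (by simp)

theorem rightSlope_le_slope (hu : ConvexOn ℝ Set.univ u) {s t : ℝ} (h : s < t) :
    rightSlope u s ≤ (u t - u s) / (t - s) := by
  rw [← slope_def_field]
  exact hu.rightDeriv_le_slope_of_mem_interior (by simp) (by simp) h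

theorem slope_le_leftSlope (hu : ConvexOn ℝ Set.univ u) {s t : ℝ} (h : s < t) :
    (u t - u s) / (t - s) ≤ leftSlope u t := by
  rw [← slope_def_field]
  exact hu.slope_le_leftDeriv_of_mem_interior (by simp) (by simp) h

theorem rightSlope_le_leftSlope (hu : ConvexOn ℝ Set.univ u) {s t : ℝ} (h : s < t) :
    rightSlope u s ≤ leftSlope u t :=
  (rightSlope_le_slope hu h).trans (slope_le_leftSlope hu h)

theorem monotone_rightSlope (hu : ConvexOn ℝ Set.univ u) : Monotone (rightSlope u) := by
  have := hu.monotoneOn_rightDeriv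
  rwa [interior_univ, monotoneOn_univ] at this

theorem monotone_leftSlope (hu : ConvexOn ℝ Set.univ u) : Monotone (leftSlope u) := by
  have := hu.monotoneOn_leftDeriv
  rwa [interior_univ, monotoneOn_univ] at this

theorem posDirDeriv_neg_one (hu : ConvexOn ℝ Set.univ u) (s : ℝ) :
    posDirDeriv (fun s => -u s) 1 s = -rightSlope u s := by
  have h1 : HasDerivWithinAt (fun h : ℝ => s + h • (1 : ℝ)) 1 (Set.Ioi 0) 0 := by
    simpa using ((hasDerivAt_id (0 : ℝ)).const_add s).hasDerivWithinAt
  have h2 : HasDerivWithinAt u (rightSlope u s) (Set.Ioi s) (s + (0 : ℝ) • (1 : ℝ)) := by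
    simpa using hasDerivWithinAt_rightSlope hu s
  have h3 := (h2.comp 0 h1 (fun h hh => by simpa using hh)).neg
  rw [mul_one] at h3
  exact h3.derivWithin (uniqueDiffWithinAt_Ioi 0)

theorem posDirDeriv_neg_neg_one (hu : ConvexOn ℝ Set.univ u) (s : ℝ) :
    posDirDeriv (fun s => -u s) (-1) s = leftSlope u s := by
  have h1 : HasDerivWithinAt (fun h : ℝ => s + h • (-1 : ℝ)) (-1) (Set.Ioi 0) 0 := by
    simpa using ((hasDerivAt_id (0 : ℝ)).neg.const_add s).hasDerivWithinAt
  have h2 : HasDerivWithinAt u (leftSlope u s) (Set.Iio s) (s + (0 : ℝ) • (-1 : ℝ)) := by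
    simpa using hasDerivWithinAt_leftSlope hu s
  have h3 := (h2.comp 0 h1 (fun h hh => by simpa using hh)).neg
  rw [mul_neg, mul_one, neg_neg] at h3
  exact h3.derivWithin (uniqueDiffWithinAt_Ioi 0)

theorem jump_neg_one (hu : ConvexOn ℝ Set.univ u) (s : ℝ) :
    jump (fun s => -u s) s 1 = leftSlope u s - rightSlope u s := by
  rw [jump, posDirDeriv_neg_one hu, posDirDeriv_neg_neg_one hu]; ring

/-- Every slope between the one-sided slopes at the ends of an interval is a subgradient at some
interior point. -/
theorem exists_subgradient (hu : ConvexOn ℝ Set.univ u) {a b m : ℝ} (hab : a < b)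
    (ha : rightSlope u a < m) (hb : m < leftSlope u b) :
    ∃ s ∈ Set.Ioo a b, leftSlope u s ≤ m ∧ m ≤ rightSlope u s := by
  have hcont : Continuous u := hu.locallyLipschitz.continuous
  -- The point is a minimiser of `u - m s` on `[a, b]`. The strict inequalities at the ends keep it
  -- in the interior, where minimality brackets `m` between the one-sided slopes.
  obtain ⟨s, hs, hmin⟩ := isCompact_Icc.exists_isMinOn (Set.nonempty_Icc.2 hab.le)
    (f := fun s => u s - m * s) (by fun_prop)
  have hmin' : ∀ x ∈ Set.Icc a b, u s - m * s ≤ u x - m * x := fun x hx => hmin hx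
  have hR : ∀ t, s < t → t ≤ b → m ≤ (u t - u s) / (t - s) := fun t h1 h2 => by
    rw [le_div_iff₀ (by linarith)]
    have := hmin' t ⟨hs.1.trans h1.le, h2⟩
    nlinarith
  have hL : ∀ t, t < s → a ≤ t → (u s - u t) / (s - t) ≤ m := fun t h1 h2 => by
    rw [div_le_iff₀ (by linarith)]
    have := hmin' t ⟨h2, h1.le.trans hs.2⟩
    nlinarith
  have hR' : s < b → m ≤ rightSlope u s := fun hsb => by
    have h := (hasDerivWithinAt_iff_tendsto_slope' Set.self_notMem_Ioi).mp
      (hasDerivWithinAt_rightSlope hu s)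
    refine ge_of_tendsto h ?_
    filter_upwards [Ioc_mem_nhdsGT hsb] with t ht
    rw [slope_def_field]
    exact hR t ht.1 ht.2
  have hL' : a < s → leftSlope u s ≤ m := fun has => by
    have h := (hasDerivWithinAt_iff_tendsto_slope' Set.self_notMem_Iio).mp
      (hasDerivWithinAt_leftSlope hu s)
    refine le_of_tendsto h ?_
    filter_upwards [Ico_mem_nhdsLT has] with t ht
    rw [slope_comm, slope_def_field]
    exact hL t ht.2 ht.1
  have has : a < s := by
    refine lt_of_le_of_ne hs.1 fun h => ?_
    subst h
    exact absurd (hR' hab) (not_le.2 ha)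
  have hsb : s < b := by
    refine lt_of_le_of_ne hs.2 fun h => ?_
    subst h
    exact absurd (hL' hab) (not_le.2 hb)
  exact ⟨s, ⟨has, hsb⟩, hL' has, hR' hsb⟩

/-- The number of kinks of a convex function in `(-t, t)` equals the total increase of its slope,
provided that the function has only countably many slopes at points of differentiability. -/
theorem poleCountLine_neg (hu : ConvexOn ℝ Set.univ u) {S : Set ℝ} (hS : S.Countable)
    (hd : ∀ s d, HasDerivAt u d s → d ∈ S) {t : ℝ} (ht : 0 < t) :
    poleCountLine t (fun s => -u s) = leftSlope u t - rightSlope u (-t) := by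
  have htt : -t < t := by linarith
  set I := {s : ℝ // |s| < t ∧ jump (fun s => -u s) s 1 < 0}
  -- `U s` is the interval of slopes skipped at the kink `s`; its length is the multiplicity. These
  -- intervals are disjoint, so it remains to see that they fill the slope range up to a null set.
  let U : I → Set ℝ := fun s => Set.Ioo (leftSlope u s.1) (rightSlope u s.1)
  have hlt : ∀ s : I, leftSlope u s.1 < rightSlope u s.1 := fun s => by
    have := s.2.2
    rw [jump_neg_one hu] at this
    linarith
  have hdisj : Pairwise (Function.onFun Disjoint U) := by
    have key : ∀ s s' : I, s.1 < s'.1 → Disjoint (U s) (U s') := fun s s' h => by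
      rw [Set.disjoint_left]
      intro x hx hx'
      have := rightSlope_le_leftSlope hu h
      linarith [hx.2, hx'.1]
    intro s s' hne
    rcases lt_or_gt_of_ne (fun h => hne (Subtype.ext h)) with h | h
    · exact key s s' h
    · exact (key s' s h).symm
  have hcount : Countable I := by
    have h : (Set.univ : Set I).Countable :=
      Set.PairwiseDisjoint.countable_of_isOpen (s := U) (fun i _ j _ hij => hdisj hij)
        (fun i _ => isOpen_Ioo) (fun i _ => Set.nonempty_Ioo.2 (hlt i))
    exact Set.countable_univ_iff.1 h
  have hsub1 : (⋃ s, U s) ⊆ Set.Icc (rightSlope u (-t)) (leftSlope u t) := by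
    refine Set.iUnion_subset fun s x hx => ?_
    have hs := abs_lt.1 s.2.1
    have h1 := rightSlope_le_leftSlope hu hs.1
    have h2 := rightSlope_le_leftSlope hu hs.2
    exact ⟨h1.trans hx.1.le, hx.2.le.trans h2⟩
  -- A slope in the range is a subgradient at some `s`. If `s` is a kink, the slope lies in `U s` or
  -- is one of its endpoints; otherwise `u` is differentiable at `s` and the slope belongs to `S`.
  -- The exceptions are countable.
  have hsub2 : Set.Ioo (rightSlope u (-t)) (leftSlope u t) ⊆
      (⋃ s, U s) ∪ (S ∪ (Set.range (fun s : I => leftSlope u s.1) ∪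
        Set.range (fun s : I => rightSlope u s.1))) := by
    intro m hm
    obtain ⟨s, hs, h1, h2⟩ := exists_subgradient hu htt hm.1 hm.2
    by_cases hj : jump (fun s => -u s) s 1 < 0
    · let s' : I := ⟨s, abs_lt.2 hs, hj⟩
      rcases h1.eq_or_lt with h | h
      · exact Or.inr (Or.inr (Or.inl ⟨s', h⟩))
      rcases h2.eq_or_lt with h' | h'
      · exact Or.inr (Or.inr (Or.inr ⟨s', h'.symm⟩))
      exact Or.inl (Set.mem_iUnion.2 ⟨s', h, h'⟩)
    · rw [jump_neg_one hu] at hj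
      have hl : leftSlope u s = m := by linarith
      have hr : rightSlope u s = m := by linarith
      refine Or.inr (Or.inl (hd s m ?_))
      have hL := hasDerivWithinAt_leftSlope hu s
      have hR := hasDerivWithinAt_rightSlope hu s
      rw [hl, hasDerivWithinAt_Iio_iff_Iic] at hL
      rw [hr, hasDerivWithinAt_Ioi_iff_Ici] at hR
      have := hL.union hR
      rwa [Set.Iic_union_Ici, hasDerivWithinAt_univ] at this
  have hvol : volume (⋃ s, U s) = ENNReal.ofReal (leftSlope u t - rightSlope u (-t)) := by
    refine le_antisymm ((measure_mono hsub1).trans_eq Real.volume_Icc) ?_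
    rw [← Real.volume_Ioo]
    refine (measure_mono hsub2).trans ((measure_union_le _ _).trans_eq ?_)
    rw [Set.Countable.measure_zero (hS.union ((Set.countable_range _).union
      (Set.countable_range _))), add_zero]
  rw [measure_iUnion hdisj (fun s => measurableSet_Ioo)] at hvol
  have h0 : 0 ≤ leftSlope u t - rightSlope u (-t) := sub_nonneg.2 (rightSlope_le_leftSlope hu htt)
  rw [poleCountLine, ← ENNReal.toReal_ofReal h0, ← hvol,
    ENNReal.tsum_toReal_eq (fun s => by simp [U])]
  refine tsum_congr fun s => ?_
  rw [Real.volume_Ioo, ENNReal.toReal_ofReal (by linarith [hlt s]), jump_neg_one hu,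
    abs_of_neg (by linarith [hlt s])]
  ring

theorem integral_rightSlope (hu : ConvexOn ℝ Set.univ u) (a b : ℝ) :
    ∫ t in a..b, rightSlope u t = u b - u a :=
  intervalIntegral.integral_eq_sub_of_hasDeriv_right
    hu.locallyLipschitz.continuous.continuousOn
    (fun s _ => hasDerivWithinAt_rightSlope hu s) (monotone_rightSlope hu).intervalIntegrable

/-- The right slope is monotone, hence continuous off a countable set. At a point of continuity it
is the limit of right slopes taken from the left, and these are at most the left slope there. -/
theorem rightSlope_ae_eq_leftSlope (hu : ConvexOn ℝ Set.univ u) :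
    rightSlope u =ᵐ[volume] leftSlope u := by
  have h : {s : ℝ | ¬ ContinuousAt (rightSlope u) s}.Countable :=
    (monotone_rightSlope hu).countable_not_continuousAt
  filter_upwards [measure_eq_zero_iff_ae_notMem.1 (h.measure_zero volume)] with s hs
  have hc : ContinuousAt (rightSlope u) s := not_not.1 hs
  refine le_antisymm ?_ (leftSlope_le_rightSlope hu s)
  have h1 : Tendsto (rightSlope u) (𝓝[<] s) (𝓝 (rightSlope u s)) :=
    hc.tendsto.mono_left nhdsWithin_le_nhds
  refine le_of_tendsto h1 ?_
  filter_upwards [self_mem_nhdsWithin] with t ht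
  exact rightSlope_le_leftSlope hu ht

theorem integral_leftSlope (hu : ConvexOn ℝ Set.univ u) (a b : ℝ) :
    ∫ t in a..b, leftSlope u t = u b - u a := by
  rw [← integral_rightSlope hu]
  refine intervalIntegral.integral_congr_ae ?_
  filter_upwards [rightSlope_ae_eq_leftSlope hu] with t ht _ using ht.symm

/-- The total kink of a convex function, integrated. -/
theorem integral_leftSlope_sub_rightSlope (hu : ConvexOn ℝ Set.univ u) (r : ℝ) :
    ∫ t in (0 : ℝ)..r, (leftSlope u t - rightSlope u (-t)) = u r + u (-r) - 2 * u 0 := by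
  have hi : IntervalIntegrable (fun t => rightSlope u (-t)) volume 0 r :=
    Antitone.intervalIntegrable fun a b hab => monotone_rightSlope hu (neg_le_neg hab)
  rw [intervalIntegral.integral_sub (monotone_leftSlope hu).intervalIntegrable hi,
    integral_leftSlope hu, intervalIntegral.integral_comp_neg (f := rightSlope u),
    integral_rightSlope hu]
  simp; ring

end Line

/-! ### Real-valued tropical entire functions -/

section Entire

variable {n : ℕ} {g h : Space n → ℝ}

/-- A real-valued function that is everywhere the attained maximum of countably many affine
functions. -/
def IsRealEntire (g : Space n → ℝ) : Prop :=
  ∃ S : Set (Space n × ℝ), S.Countable ∧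
    ∀ x, IsGreatest ((fun p : Space n × ℝ => p.2 + inner ℝ p.1 x) '' S) (g x)

theorem isRealEntire_affine (m : Space n) (b : ℝ) :
    IsRealEntire (fun x => b + inner ℝ m x) := by
  refine ⟨{(m, b)}, Set.countable_singleton _, fun x => ?_⟩
  simp

theorem IsRealEntire.sup (hg : IsRealEntire g) (hh : IsRealEntire h) :
    IsRealEntire (fun x => g x ⊔ h x) := by
  obtain ⟨S, hS, hg⟩ := hg
  obtain ⟨S', hS', hh⟩ := hh
  refine ⟨S ∪ S', hS.union hS', fun x => ?_⟩
  rw [Set.image_union]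
  exact (hg x).union (hh x)

theorem IsRealEntire.add (hg : IsRealEntire g) (hh : IsRealEntire h) :
    IsRealEntire (fun x => g x + h x) := by
  obtain ⟨S, hS, hg⟩ := hg
  obtain ⟨S', hS', hh⟩ := hh
  refine ⟨(fun p : (Space n × ℝ) × (Space n × ℝ) => p.1 + p.2) '' (S ×ˢ S'),
    (hS.prod hS').image _, fun x => ⟨?_, ?_⟩⟩
  · obtain ⟨p, hp, hpx⟩ := (hg x).1
    obtain ⟨p', hp', hpx'⟩ := (hh x).1
    refine ⟨p + p', ⟨(p, p'), ⟨hp, hp'⟩, rfl⟩, ?_⟩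
    simp only [← hpx, ← hpx', Prod.fst_add, Prod.snd_add, inner_add_left]
    ring
  · rintro _ ⟨_, ⟨⟨p, p'⟩, ⟨hp, hp'⟩, rfl⟩, rfl⟩
    have h1 := (hg x).2 ⟨p, hp, rfl⟩
    have h2 := (hh x).2 ⟨p', hp', rfl⟩
    simp only [Prod.fst_add, Prod.snd_add, inner_add_left] at h1 h2 ⊢
    linarith

theorem IsRealEntire.const_add (hg : IsRealEntire g) (b : ℝ) :
    IsRealEntire (fun x => b + g x) := by
  simpa using (isRealEntire_affine (0 : Space n) b).add hg

theorem IsRealEntire.comp_add_right (hg : IsRealEntire g) (c : Space n) :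
    IsRealEntire (fun x => g (x + c)) := by
  obtain ⟨S, hS, hg⟩ := hg
  refine ⟨(fun p : Space n × ℝ => (p.1, p.2 + inner ℝ p.1 c)) '' S, hS.image _, fun x => ?_⟩
  rw [Set.image_image]
  convert hg (x + c) using 2
  simp only [inner_add_right]
  ring

theorem IsRealEntire.exists_support (hg : IsRealEntire g) (x : Space n) :
    ∃ (m : Space n) (b : ℝ), (∀ y, b + inner ℝ m y ≤ g y) ∧ g x = b + inner ℝ m x := by
  obtain ⟨S, hS, hg⟩ := hg
  obtain ⟨p, hp, hpx⟩ := (hg x).1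
  exact ⟨p.1, p.2, fun y => (hg y).2 ⟨p, hp, rfl⟩, hpx.symm⟩

theorem IsRealEntire.convexOn (hg : IsRealEntire g) : ConvexOn ℝ Set.univ g := by
  refine ⟨convex_univ, fun x _ y _ a b ha hb hab => ?_⟩
  obtain ⟨m, d, hle, heq⟩ := hg.exists_support (a • x + b • y)
  rw [heq, inner_add_right, inner_smul_right, inner_smul_right, smul_eq_mul, smul_eq_mul]
  have h1 := mul_le_mul_of_nonneg_left (hle x) ha
  have h2 := mul_le_mul_of_nonneg_left (hle y) hb
  have h3 : d = a * d + b * d := by rw [← add_mul, hab, one_mul]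
  linarith

theorem IsRealEntire.continuous (hg : IsRealEntire g) : Continuous g :=
  hg.convexOn.locallyLipschitz.continuous

/-- Only countably many slopes occur at the points of differentiability of the restriction of a
tropical entire function to a line. -/
theorem IsRealEntire.countable_slopes (hg : IsRealEntire g) (θ : Space n) :
    ∃ T : Set ℝ, T.Countable ∧ ∀ s d, HasDerivAt (fun s : ℝ => g (s • θ)) d s → d ∈ T := by
  obtain ⟨S, hS, hg⟩ := hg
  refine ⟨(fun p : Space n × ℝ => inner ℝ p.1 θ) '' S, hS.image _, fun s d hd => ?_⟩
  obtain ⟨p, hp, hpx⟩ := (hg (s • θ)).1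
  refine ⟨p, hp, ?_⟩
  have hlin : HasDerivAt (fun s : ℝ => p.2 + s * inner ℝ p.1 θ) (inner ℝ p.1 θ) s := by
    simpa using ((hasDerivAt_id s).mul_const (inner ℝ p.1 θ)).const_add p.2
  -- The affine piece attaining the maximum at `s • θ` touches `g` from below, so where `g` is
  -- differentiable along the line the derivative is the slope of that piece.
  have hmin : IsLocalMin (fun s : ℝ => g (s • θ) - (p.2 + s * inner ℝ p.1 θ)) s := by
    refine Filter.Eventually.of_forall fun t => ?_
    have h1 := (hg (t • θ)).2 ⟨p, hp, rfl⟩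
    simp only [inner_smul_right] at h1 hpx
    linarith
  have := hmin.hasDerivAt_eq_zero (hd.sub hlin)
  linarith

/-- A tropical entire function is either identically `-∞` or real-valued. -/
theorem IsEntire.eq_bot_or_real {f : Space n → Trop} (hf : IsEntire f) :
    (∀ x, f x = ⊥) ∨ ∃ g : Space n → ℝ, IsRealEntire g ∧ ∀ x, f x = (g x : Trop) := by
  obtain ⟨a, m, h⟩ := hf
  by_cases hbot : ∀ i, a i = ⊥
  · left
    intro x
    obtain ⟨i, hi⟩ := (h x).1
    simp only [hbot i, WithBot.bot_add] at hi
    exact hi.symm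
  right
  push Not at hbot
  obtain ⟨i₀, hi₀⟩ := hbot
  have hne : ∀ x, f x ≠ ⊥ := fun x hx => by
    have := (h x).2 ⟨i₀, rfl⟩
    rw [hx, le_bot_iff, WithBot.add_eq_bot] at this
    exact this.elim hi₀ (WithBot.coe_ne_bot)
  have hcoe : ∀ x, ((f x).unbot (hne x) : Trop) = f x := fun x => WithBot.coe_unbot _ _
  -- `unbotD` sends a coefficient `⊥` to the spurious value `0`. The intersection discards such
  -- terms.
  refine ⟨fun x => (f x).unbot (hne x), ⟨Set.range (fun i => (m i, (a i).unbotD 0)) ∩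
    {p | ∃ i, m i = p.1 ∧ a i = (p.2 : Trop)}, (Set.countable_range _).mono
      Set.inter_subset_left, fun x => ⟨?_, ?_⟩⟩, fun x => (hcoe x).symm⟩
  · obtain ⟨i, hi⟩ := (h x).1
    have hai : a i ≠ ⊥ := fun h0 => hne x (by rw [← hi]; simp [h0])
    obtain ⟨b, hb⟩ := WithBot.ne_bot_iff_exists.1 hai
    refine ⟨(m i, b), ⟨⟨i, by simp [← hb]⟩, ⟨i, rfl, hb.symm⟩⟩, ?_⟩
    rw [← WithBot.coe_inj, hcoe, ← hi]
    simp [← hb]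
  · rintro _ ⟨⟨m', b⟩, ⟨_, ⟨i, hmi, hai⟩⟩, rfl⟩
    have := (h x).2 ⟨i, rfl⟩
    simp only at hmi hai
    rw [← WithBot.coe_le_coe, hcoe]
    simpa [hmi, hai] using this

/-- A tropical entire function below an affine function differs from it by a constant. -/
theorem IsRealEntire.eq_affine_of_le (hg : IsRealEntire g) {m : Space n} {b : ℝ}
    (hle : ∀ x, g x ≤ b + inner ℝ m x) : ∃ b', ∀ x, g x = b' + inner ℝ m x := by
  obtain ⟨m', b', hs, h0⟩ := hg.exists_support 0
  have hm : ∀ {m' : Space n} {b' : ℝ}, (∀ y, b' + inner ℝ m' y ≤ g y) → m' = m := by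
    intro m' b' hs
    by_contra hne
    have hpos : 0 < inner ℝ (m' - m) (m' - m) := real_inner_self_pos.2 (sub_ne_zero.2 hne)
    -- At `t • (m' - m)` the supporting function exceeds the affine upper bound by exactly `1`. So
    -- every supporting function of `g` has slope `m`, and comparison at `0` shows that none has a
    -- larger constant term than the one at `0`.
    set t := (b - b' + 1) / inner ℝ (m' - m) (m' - m)
    have h1 := (hs (t • (m' - m))).trans (hle _)
    have h2 : t * inner ℝ (m' - m) (m' - m) = b - b' + 1 := div_mul_cancel₀ _ hpos.ne'
    have h3 : t * inner ℝ (m' - m) (m' - m)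
        = inner ℝ m' (t • (m' - m)) - inner ℝ m (t • (m' - m)) := by
      rw [← inner_sub_left, inner_smul_right]
    linarith
  refine ⟨b', fun x => le_antisymm ?_ (by rw [← hm hs]; exact hs x)⟩
  obtain ⟨m₂, b₂, hs₂, hx⟩ := hg.exists_support x
  have h2 := hs₂ 0
  rw [hm hs₂] at hx h2
  rw [h0, hm hs] at h2
  simp only [inner_zero_right, add_zero] at h2
  linarith

end Entire

/-! ### The normalized surface measure -/

section Sphere

open scoped NNReal ENNReal Pointwise

variable {n : ℕ}

/-- The normalized surface measure of the unit sphere. -/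
def sphereProb (n : ℕ) : Measure (Metric.sphere (0 : Space n) 1) :=
  ((volume : Measure (Space n)).toSphere Set.univ)⁻¹ • (volume : Measure (Space n)).toSphere

theorem sphereMean_eq (F : Space n → ℝ) : sphereMean n F = ∫ θ, F θ ∂sphereProb n := rfl

instance [Nontrivial (Space n)] : IsProbabilityMeasure (sphereProb n) := by
  have : NeZero (volume : Measure (Space n)).toSphere := ⟨Measure.toSphere_ne_zero _⟩
  unfold sphereProb
  infer_instance

instance [Nontrivial (Space n)] : (sphereProb n).IsOpenPosMeasure := by
  refine ⟨fun U hU hne h0 => hU.measure_ne_zero (volume : Measure (Space n)).toSphere hne ?_⟩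
  rw [sphereProb, Measure.smul_apply, smul_eq_mul, mul_eq_zero] at h0
  exact h0.resolve_left (ENNReal.inv_ne_zero.2 (measure_ne_top _ _))

/-- The open cone of height one over a subset of the unit sphere. -/
abbrev unitCone (A : Set (Metric.sphere (0 : Space n) 1)) : Set (Space n) :=
  Set.Ioo (0 : ℝ) 1 • ((↑) '' A)

/-- The surface measure of a set is a fixed multiple of the volume of the cone over it, so
distortion on the sphere can be estimated by volumes in space. -/
theorem map_sphereProb_le {ψ : Metric.sphere (0 : Space n) 1 → Metric.sphere (0 : Space n) 1}
    (hψ : Measurable ψ) {K : ℝ≥0∞}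
    (h : ∀ A, MeasurableSet A → volume (unitCone (ψ ⁻¹' A)) ≤ K * volume (unitCone A)) :
    (sphereProb n).map ψ ≤ K • sphereProb n := by
  refine Measure.le_iff.2 fun A hA => ?_
  rw [Measure.map_apply hψ hA, sphereProb, Measure.smul_apply, Measure.smul_apply,
    Measure.smul_apply, Measure.toSphere_apply' _ hA, Measure.toSphere_apply' _ (hψ hA)]
  simp only [smul_eq_mul]
  rw [mul_left_comm K, mul_left_comm K]
  gcongr
  exact h A hA

theorem map_neg_sphereProb :
    (sphereProb n).map (fun θ => -θ) = sphereProb n := by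
  have key : (sphereProb n).map (fun θ => -θ) ≤ sphereProb n := by
    have := map_sphereProb_le (n := n) (ψ := fun θ => -θ) continuous_neg.measurable (K := 1)
      fun A _ => ?_
    · rwa [one_smul] at this
    rw [one_mul, ← Measure.measure_neg volume (unitCone A)]
    refine measure_mono ?_
    rintro _ ⟨t, ht, _, ⟨θ, hθ, rfl⟩, rfl⟩
    rw [Set.mem_neg]
    exact ⟨t, ht, ((-θ : Metric.sphere (0 : Space n) 1) : Space n), ⟨-θ, hθ, rfl⟩, by simp⟩
  -- Pushing the inequality forward by the involution once more reverses it.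
  refine le_antisymm key ?_
  have h2 := Measure.map_mono (f := fun θ : Metric.sphere (0 : Space n) 1 => -θ) key
    continuous_neg.measurable
  rw [Measure.map_map continuous_neg.measurable continuous_neg.measurable] at h2
  simpa [Function.comp_def] using h2

theorem integral_sphereProb_neg (F : Space n → ℝ) :
    ∫ θ, F (-(θ : Space n)) ∂sphereProb n = ∫ θ, F θ ∂sphereProb n := by
  have h : MeasurePreserving (fun θ : Metric.sphere (0 : Space n) 1 => -θ)
      (sphereProb n) (sphereProb n) := ⟨continuous_neg.measurable, map_neg_sphereProb⟩
  exact h.integral_comp (Homeomorph.neg _).measurableEmbedding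
    (fun θ : Metric.sphere (0 : Space n) 1 => F θ)

theorem integrable_sphereProb [Nontrivial (Space n)]
    {F : Metric.sphere (0 : Space n) 1 → ℝ} (hF : Continuous F) : Integrable F (sphereProb n) :=
  hF.integrable_of_hasCompactSupport (HasCompactSupport.of_compactSpace F)

/-- Preimages under expanding maps of Euclidean space have controlled volume. -/
theorem volume_preimage_le_of_antilipschitz {Ψ : Space n → Space n} {K : ℝ≥0}
    (hΨ : AntilipschitzWith K Ψ) (B : Set (Space n)) :
    volume (Ψ ⁻¹' B) ≤ (K : ℝ≥0∞) ^ (n : ℝ) * volume B := by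
  -- Lebesgue measure is a multiple of `n`-dimensional Hausdorff measure, to which the antilipschitz
  -- estimate applies.
  have h := Measure.isAddLeftInvariant_eq_smul (volume : Measure (Space n))
    (Measure.hausdorffMeasure (n : ℝ))
  rw [h, Measure.smul_apply, Measure.smul_apply]
  have := hΨ.hausdorffMeasure_preimage_le (d := (n : ℝ)) (Nat.cast_nonneg n) B
  simp only [ENNReal.smul_def, smul_eq_mul]
  rw [mul_left_comm]
  gcongr

theorem half_le_norm_add {w : Space n} (hw : ‖w‖ ≤ 1 / 2)
    (θ : Metric.sphere (0 : Space n) 1) : 1 / 2 ≤ ‖(θ : Space n) + w‖ := by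
  have h1 : ‖(θ : Space n)‖ = 1 := by simp
  have h2 := norm_sub_norm_le (θ : Space n) (-w)
  rw [sub_neg_eq_add, norm_neg] at h2
  linarith

theorem norm_add_le_of_sphere (w : Space n) (θ : Metric.sphere (0 : Space n) 1) :
    ‖(θ : Space n) + w‖ ≤ 1 + ‖w‖ := by
  have h1 : ‖(θ : Space n)‖ = 1 := by simp
  have h2 := norm_add_le (θ : Space n) w
  linarith

/-- The direction of `θ + w`, seen as a point of the unit sphere. -/
def shiftDir (w : Space n) (hw : ‖w‖ ≤ 1 / 2) (θ : Metric.sphere (0 : Space n) 1) :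
    Metric.sphere (0 : Space n) 1 :=
  ⟨‖(θ : Space n) + w‖⁻¹ • ((θ : Space n) + w), by
    have h := half_le_norm_add hw θ
    rw [mem_sphere_zero_iff_norm, norm_smul, norm_inv, norm_norm, inv_mul_cancel₀]
    linarith⟩

theorem norm_smul_shiftDir {w : Space n} (hw : ‖w‖ ≤ 1 / 2)
    (θ : Metric.sphere (0 : Space n) 1) :
    ‖(θ : Space n) + w‖ • (shiftDir w hw θ : Space n) = θ + w := by
  have h := half_le_norm_add hw θ
  rw [shiftDir, smul_smul, mul_inv_cancel₀ (by linarith), one_smul]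

theorem continuous_shiftDir {w : Space n} (hw : ‖w‖ ≤ 1 / 2) : Continuous (shiftDir w hw) := by
  refine Continuous.subtype_mk ?_ _
  have hc : Continuous fun θ : Metric.sphere (0 : Space n) 1 => (θ : Space n) + w := by fun_prop
  refine Continuous.smul (Continuous.inv₀ hc.norm fun θ => ?_) hc
  have h := half_le_norm_add hw θ
  linarith

/-- This is the positively homogeneous extension of `θ ↦ θ + w`, used to compare cones. The
perturbation `‖x‖ • w` is `1/2`-Lipschitz, so distances shrink by at most a factor `2`. -/
theorem antilipschitz_add_norm_smul {w : Space n} (hw : ‖w‖ ≤ 1 / 2) :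
    AntilipschitzWith 2 (fun x : Space n => x + ‖x‖ • w) := by
  refine AntilipschitzWith.of_le_mul_dist fun x y => ?_
  rw [dist_eq_norm, dist_eq_norm]
  have h1 : x - y = (x + ‖x‖ • w - (y + ‖y‖ • w)) - (‖x‖ - ‖y‖) • w := by
    rw [sub_smul]; abel
  have h2 := norm_sub_le (x + ‖x‖ • w - (y + ‖y‖ • w)) ((‖x‖ - ‖y‖) • w)
  rw [← h1, norm_smul, Real.norm_eq_abs] at h2
  have h3 := abs_norm_sub_norm_le x y
  have h4 : |‖x‖ - ‖y‖| * ‖w‖ ≤ ‖x - y‖ * (1 / 2) := by gcongr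
  push_cast
  linarith

/-- The map `θ ↦ (θ + w) / ‖θ + w‖` distorts the surface measure by a bounded factor. -/
theorem exists_map_shiftDir_le (n : ℕ) :
    ∃ C : ℝ≥0, ∀ (w : Space n) (hw : ‖w‖ ≤ 1 / 2),
      (sphereProb n).map (shiftDir w hw) ≤ C • sphereProb n := by
  -- The factor `2 ^ n` comes from the antilipschitz constant; `(3 / 2) ^ n` comes from dilating the
  -- target cone, since `‖θ + w‖ ≤ 3 / 2`.
  refine ⟨2 ^ (n : ℝ) * Real.toNNReal ((3 / 2) ^ n), fun w hw => ?_⟩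
  have := map_sphereProb_le (continuous_shiftDir hw).measurable
    (K := (2 : ℝ≥0) ^ (n : ℝ) * ENNReal.ofReal ((3 / 2) ^ n)) fun A _ => ?_
  · refine this.trans_eq ?_
    ext B
    rw [Measure.smul_apply, Measure.smul_apply, ENNReal.smul_def]
    push_cast
    rw [ENNReal.coe_rpow_of_nonneg _ (Nat.cast_nonneg n)]
    rfl
  have hsub : unitCone (shiftDir w hw ⁻¹' A) ⊆
      (fun x : Space n => x + ‖x‖ • w) ⁻¹' ((3 / 2 : ℝ) • unitCone A) := by
    rintro _ ⟨t, ht, _, ⟨θ, hθ, rfl⟩, rfl⟩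
    have h1 := half_le_norm_add hw θ
    have h2 := norm_add_le_of_sphere w θ
    have hn : ‖t • (θ : Space n)‖ = t := by
      rw [norm_smul, Real.norm_of_nonneg ht.1.le]; simp
    refine ⟨(t * ‖(θ : Space n) + w‖ * (2 / 3)) • (shiftDir w hw θ : Space n),
      ⟨_, ⟨?_, ?_⟩, _, ⟨_, hθ, rfl⟩, rfl⟩, ?_⟩
    · have := ht.1
      positivity
    · have h3 : t * ‖(θ : Space n) + w‖ ≤ t * (3 / 2) :=
        mul_le_mul_of_nonneg_left (by linarith) ht.1.le
      linarith [ht.2]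
    · simp only [hn, smul_smul]
      rw [← smul_add, ← norm_smul_shiftDir hw θ, smul_smul, norm_smul_shiftDir hw θ]
      congr 1
      ring
  calc volume (unitCone (shiftDir w hw ⁻¹' A))
      ≤ (2 : ℝ≥0) ^ (n : ℝ) * volume ((3 / 2 : ℝ) • unitCone A) :=
        (measure_mono hsub).trans
          (volume_preimage_le_of_antilipschitz (antilipschitz_add_norm_smul hw) _)
    _ = _ := by
        rw [Measure.addHaar_smul, mul_assoc, finrank_euclideanSpace_fin,
          abs_of_pos (by positivity)]

end Sphere

/-! ### The Jensen formula -/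

section Jensen

variable {n : ℕ} {g : Space n → ℝ}

theorem convexOn_comp_line (hg : ConvexOn ℝ Set.univ g) (x θ : Space n) :
    ConvexOn ℝ Set.univ (fun s : ℝ => g (x + s • θ)) := by
  refine ⟨convex_univ, fun s _ t _ a b ha hb hab => ?_⟩
  have := hg.2 (Set.mem_univ (x + s • θ)) (Set.mem_univ (x + t • θ)) ha hb hab
  convert this using 2
  have hx : x = (a + b) • x := by rw [hab, one_smul]
  conv_lhs => rw [hx]
  module

theorem convexOn_comp_smul (hg : ConvexOn ℝ Set.univ g) (θ : Space n) :
    ConvexOn ℝ Set.univ (fun s : ℝ => g (s • θ)) := by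
  simpa using convexOn_comp_line hg 0 θ

/-- The total increase on `[-t, t]` of the slope of `g` in the direction `θ`. -/
def slopeGain (g : Space n → ℝ) (t : ℝ) (θ : Space n) : ℝ :=
  leftSlope (fun s : ℝ => g (s • θ)) t - rightSlope (fun s : ℝ => g (s • θ)) (-t)

theorem poleCount_neg (hg : IsRealEntire g) {t : ℝ} (ht : 0 < t) :
    poleCount t (fun x => -g x) = ∫ θ, slopeGain g t θ ∂sphereProb n := by
  rw [poleCount, sphereMean_eq]
  refine integral_congr_ae (Eventually.of_forall fun θ => ?_)
  obtain ⟨T, hT, hd⟩ := hg.countable_slopes (θ : Space n)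
  exact poleCountLine_neg (convexOn_comp_smul hg.convexOn _) hT hd ht

/-- One-sided slopes are limits of difference quotients with steps `± 1 / (k + 1)`, measurable
jointly in radius and direction. Joint measurability is what Fubini needs in Jensen's formula. -/
theorem measurable_slopeGain (hg : ConvexOn ℝ Set.univ g) :
    Measurable fun p : ℝ × Metric.sphere (0 : Space n) 1 => slopeGain g p.1 p.2 := by
  have hcont : Continuous g := hg.locallyLipschitz.continuous
  let ε : ℕ → ℝ := fun k => 1 / ((k : ℝ) + 1)
  have hε : ∀ k, 0 < ε k := fun k => Nat.one_div_pos_of_nat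
  have hε0 : Tendsto ε atTop (𝓝 0) := tendsto_one_div_add_atTop_nhds_zero_nat
  refine Measurable.sub ?_ ?_
  · refine measurable_of_tendsto_metrizable (f := fun k p =>
      (g ((p.1 - ε k) • (p.2 : Space n)) - g (p.1 • (p.2 : Space n))) / ((p.1 - ε k) - p.1))
      (fun k => Measurable.div ?_ (by fun_prop)) (tendsto_pi_nhds.2 fun p => ?_)
    · exact Continuous.measurable (by fun_prop)
    · have h := (hasDerivWithinAt_iff_tendsto_slope' Set.self_notMem_Iio).mp
        (hasDerivWithinAt_leftSlope (convexOn_comp_smul hg (p.2 : Space n)) p.1)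
      have hlim : Tendsto (fun k => p.1 - ε k) atTop (𝓝[<] p.1) := by
        refine tendsto_nhdsWithin_iff.2 ⟨by simpa using hε0.const_sub p.1, ?_⟩
        exact Eventually.of_forall fun k => by simpa using hε k
      simpa [Function.comp_def, slope_def_field] using h.comp hlim
  · refine measurable_of_tendsto_metrizable (f := fun k p =>
      (g ((-p.1 + ε k) • (p.2 : Space n)) - g ((-p.1) • (p.2 : Space n))) / ((-p.1 + ε k) - (-p.1)))
      (fun k => Measurable.div ?_ (by fun_prop)) (tendsto_pi_nhds.2 fun p => ?_)
    · exact Continuous.measurable (by fun_prop)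
    · have h := (hasDerivWithinAt_iff_tendsto_slope' Set.self_notMem_Ioi).mp
        (hasDerivWithinAt_rightSlope (convexOn_comp_smul hg (p.2 : Space n)) (-p.1))
      have hlim : Tendsto (fun k => -p.1 + ε k) atTop (𝓝[>] (-p.1)) := by
        refine tendsto_nhdsWithin_iff.2 ⟨by simpa using hε0.const_add (-p.1), ?_⟩
        exact Eventually.of_forall fun k => by simpa using hε k
      simpa [Function.comp_def, slope_def_field] using h.comp hlim

theorem slopeGain_nonneg (hg : ConvexOn ℝ Set.univ g) {t : ℝ} (ht : 0 < t) (θ : Space n) :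
    0 ≤ slopeGain g t θ :=
  sub_nonneg.2 (rightSlope_le_leftSlope (convexOn_comp_smul hg θ) (by linarith))

/-- Chord slopes over unit steps beyond `±t` dominate the one-sided slopes. This bounds the gain by
values of `g` on a compact ball, hence makes it integrable. -/
theorem slopeGain_le (hg : ConvexOn ℝ Set.univ g) (t : ℝ) (θ : Space n) :
    slopeGain g t θ ≤
      g ((t + 1) • θ) - g (t • θ) + (g ((-t - 1) • θ) - g ((-t) • θ)) := by
  have hu := convexOn_comp_smul hg θ
  have h1 := (leftSlope_le_rightSlope hu t).trans (rightSlope_le_slope hu (lt_add_one t))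
  have h2 := (slope_le_leftSlope hu (sub_one_lt (-t))).trans (leftSlope_le_rightSlope hu (-t))
  simp only [add_sub_cancel_left, sub_sub_cancel, div_one] at h1 h2
  rw [slopeGain]
  linarith

theorem exists_abs_le_of_continuous (hg : Continuous g) (R : ℝ) :
    ∃ M, ∀ s : ℝ, |s| ≤ R → ∀ θ : Metric.sphere (0 : Space n) 1, |g (s • (θ : Space n))| ≤ M := by
  obtain ⟨M, hM⟩ := (isCompact_closedBall (0 : Space n) R).exists_bound_of_continuousOn
    hg.continuousOn
  refine ⟨M, fun s hs θ => hM _ ?_⟩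
  rw [mem_closedBall_zero_iff, norm_smul]
  simpa using hs

/-- **Jensen formula** for tropical entire functions. -/
theorem counting_neg [Nontrivial (Space n)] (hg : IsRealEntire g) {r : ℝ} (hr : 0 ≤ r) :
    counting r (fun x => -g x) = ∫ θ, g (r • (θ : Space n)) ∂sphereProb n - g 0 := by
  have hconv := hg.convexOn
  have hcont := hg.continuous
  have h1 : ∫ t in (0 : ℝ)..r, poleCount t (fun x => -g x) =
      ∫ t in Set.Ioc (0 : ℝ) r, ∫ θ, slopeGain g t θ ∂sphereProb n := by
    rw [intervalIntegral.integral_of_le hr]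
    exact setIntegral_congr_fun measurableSet_Ioc fun t ht => poleCount_neg hg ht.1
  obtain ⟨M, hM⟩ := exists_abs_le_of_continuous hcont (r + 1)
  have hint : Integrable (Function.uncurry fun (t : ℝ) (θ : Metric.sphere (0 : Space n) 1) =>
      slopeGain g t θ) ((volume.restrict (Set.Ioc (0 : ℝ) r)).prod (sphereProb n)) := by
    refine Integrable.of_bound (measurable_slopeGain hconv).aestronglyMeasurable (4 * M) ?_
    have hae : ∀ᵐ p ∂(volume.restrict (Set.Ioc (0 : ℝ) r)).prod (sphereProb n),
        p.1 ∈ Set.Ioc (0 : ℝ) r :=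
      Measure.quasiMeasurePreserving_fst.ae (ae_restrict_mem measurableSet_Ioc)
    filter_upwards [hae] with p hp
    have h0 := slopeGain_nonneg hconv hp.1 (p.2 : Space n)
    have h2 := slopeGain_le hconv p.1 (p.2 : Space n)
    have b1 := abs_le.1 (hM (p.1 + 1) (by rw [abs_of_pos] <;> linarith [hp.1, hp.2]) p.2)
    have b2 := abs_le.1 (hM p.1 (by rw [abs_of_pos] <;> linarith [hp.1, hp.2]) p.2)
    have b3 := abs_le.1 (hM (-p.1 - 1) (by rw [abs_of_neg] <;> linarith [hp.1, hp.2]) p.2)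
    have b4 := abs_le.1 (hM (-p.1) (by rw [abs_of_neg] <;> linarith [hp.1, hp.2]) p.2)
    rw [Function.uncurry, Real.norm_of_nonneg h0]
    linarith
  rw [counting, h1, integral_integral_swap hint]
  have h2 : ∀ θ : Metric.sphere (0 : Space n) 1, ∫ t in Set.Ioc (0 : ℝ) r, slopeGain g t θ =
      g (r • (θ : Space n)) + g (r • -(θ : Space n)) - 2 * g 0 := fun θ => by
    rw [← intervalIntegral.integral_of_le hr]
    have := integral_leftSlope_sub_rightSlope (convexOn_comp_smul hconv (θ : Space n)) r
    simpa [slopeGain] using this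
  simp_rw [h2]
  have i1 : Integrable (fun θ : Metric.sphere (0 : Space n) 1 => g (r • (θ : Space n)))
      (sphereProb n) := integrable_sphereProb (by fun_prop)
  have i2 : Integrable (fun θ : Metric.sphere (0 : Space n) 1 => g (r • -(θ : Space n)))
      (sphereProb n) := integrable_sphereProb (by fun_prop)
  have i12 : Integrable (fun θ : Metric.sphere (0 : Space n) 1 =>
      g (r • (θ : Space n)) + g (r • -(θ : Space n))) (sphereProb n) := i1.add i2
  -- The terms at `θ` and `-θ` have equal means, which cancels the factor `1/2` in the counting
  -- function.
  rw [integral_sub i12 (integrable_const _), integral_add i1 i2,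
    integral_sphereProb_neg (fun x => g (r • x))]
  simp
  ring

end Jensen

/-! ### Exceptional sets of zero upper density -/

section Growth

open scoped ENNReal

theorem zeroUpperDensity_of_eventually_le {E : Set ℝ}
    (h : ∀ ε > 0, ∀ᶠ R in atTop, volume (E ∩ Set.Icc 1 R) ≤ ENNReal.ofReal (ε * R)) :
    ZeroUpperDensity E := by
  have key : Tendsto (fun r : ℝ => volume (E ∩ Set.Icc 1 r) / ENNReal.ofReal r) atTop (𝓝 0) := by
    refine ENNReal.tendsto_nhds_zero.2 fun ε hε => ?_
    obtain ⟨δ, hδ, hδε⟩ := ENNReal.lt_iff_exists_nnreal_btwn.1 hε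
    have hδ0 : (0 : ℝ) < δ := by exact_mod_cast hδ
    filter_upwards [h δ hδ0, eventually_gt_atTop 0] with r hr hr0
    refine ENNReal.div_le_of_le_mul (hr.trans ?_)
    rw [ENNReal.ofReal_mul hδ0.le, ENNReal.ofReal_coe_nnreal]
    gcongr
  exact key.limsup_eq

/-- An increasing sequence of sets of zero upper density is eventually contained in a single set of
zero upper density. -/
theorem exists_zeroUpperDensity_of_monotone {E : ℕ → Set ℝ} (hE : ∀ k, MeasurableSet (E k))
    (hmono : Monotone E)
    (h : ∀ k, ∀ ε > 0, ∀ᶠ R in atTop, volume (E k ∩ Set.Icc 1 R) ≤ ENNReal.ofReal (ε * R)) :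
    ∃ F : Set ℝ, MeasurableSet F ∧ ZeroUpperDensity F ∧ ∀ k, ∀ᶠ r in atTop, r ∉ F → r ∉ E k := by
  have h' : ∀ k : ℕ, ∃ ρ : ℝ, ∀ R ≥ ρ,
      volume (E k ∩ Set.Icc 1 R) ≤ ENNReal.ofReal (1 / ((k : ℝ) + 1) * R) := fun k =>
    eventually_atTop.1 (h k _ Nat.one_div_pos_of_nat)
  choose ρ hρ using h'
  -- The thresholds `r k` dominate `ρ k`, increase and are unbounded. In the diagonal union below,
  -- `E k` counts only from `r k` on.
  let r : ℕ → ℝ := fun k => ∑ j ∈ Finset.range (k + 1), (|ρ j| + 1)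
  have hr_mono : Monotone r := monotone_nat_of_le_succ fun k => by
    simp only [r]
    rw [Finset.sum_range_succ _ (k + 1)]
    have := abs_nonneg (ρ (k + 1))
    linarith
  have hr_ge : ∀ k, ρ k ≤ r k := fun k => by
    simp only [r]
    have h1 := Finset.single_le_sum (f := fun j => |ρ j| + 1) (s := Finset.range (k + 1))
      (fun j _ => by positivity) (Finset.self_mem_range_succ k)
    have := le_abs_self (ρ k)
    linarith
  have hr_large : ∀ k : ℕ, (k : ℝ) ≤ r k := fun k => by
    have h1 : ∑ j ∈ Finset.range (k + 1), (1 : ℝ) ≤ r k :=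
      Finset.sum_le_sum fun j _ => by linarith [abs_nonneg (ρ j)]
    simp only [Finset.sum_const, Finset.card_range, nsmul_eq_mul, mul_one] at h1
    push_cast at h1
    linarith
  refine ⟨⋃ k, E k ∩ Set.Ici (r k), MeasurableSet.iUnion fun k => (hE k).inter measurableSet_Ici,
    zeroUpperDensity_of_eventually_le fun ε hε => ?_, fun k => ?_⟩
  · obtain ⟨k₀, hk₀⟩ := exists_nat_one_div_lt hε
    filter_upwards [eventually_ge_atTop (r k₀), eventually_ge_atTop 0] with R hR hR0
    have hex : ∃ j, R < r j := by
      obtain ⟨j, hj⟩ := exists_nat_gt R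
      exact ⟨j, hj.trans_le (hr_large j)⟩
    classical
    obtain ⟨k, hk⟩ : ∃ k, Nat.find hex = k + 1 := by
      refine Nat.exists_eq_succ_of_ne_zero fun h0 => ?_
      have h1 := Nat.find_spec hex
      rw [h0] at h1
      exact absurd (h1.trans_le (hr_mono (Nat.zero_le k₀))) (not_lt.2 hR)
    have hspec : R < r (k + 1) := hk ▸ Nat.find_spec hex
    have hkR : r k ≤ R := not_lt.1 (Nat.find_min hex (by omega))
    have hk₀k : k₀ ≤ k := by
      by_contra hlt
      exact absurd (hspec.trans_le (hr_mono (by omega : k + 1 ≤ k₀))) (not_lt.2 hR)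
    -- As `r k ≤ R < r (k + 1)`, only indices `i ≤ k` contribute below `R`, and `E i ⊆ E k` for
    -- these.
    have hsub : (⋃ i, E i ∩ Set.Ici (r i)) ∩ Set.Icc 1 R ⊆ E k ∩ Set.Icc 1 R := by
      rintro x ⟨hx, hxR⟩
      obtain ⟨i, hxi, hri⟩ := Set.mem_iUnion.1 hx
      refine ⟨hmono ?_ hxi, hxR⟩
      by_contra hlt
      have := hr_mono (by omega : k + 1 ≤ i)
      have h2 : r i ≤ x := hri
      linarith [hxR.2]
    refine (measure_mono hsub).trans ((hρ k R ((hr_ge k).trans hkR)).trans ?_)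
    refine ENNReal.ofReal_le_ofReal (mul_le_mul_of_nonneg_right (le_trans ?_ hk₀.le) hR0)
    exact Nat.one_div_le_one_div hk₀k
  · filter_upwards [eventually_ge_atTop (r k)] with x hx hxF hxE
    exact hxF (Set.mem_iUnion.2 ⟨k, hxE, hx⟩)

/-- The set where a monotone function increases by more than one in `k` steps is controlled by
the size of the function. -/
theorem volume_increment_le {u : ℝ → ℝ} (hu : Monotone u) (h0 : ∀ r, 0 ≤ u r) (k : ℕ) {R : ℝ}
    (hR : 1 ≤ R) :
    volume ({r | 1 < u (r + k) - u r} ∩ Set.Icc 1 R) ≤ ENNReal.ofReal (k * u (R + k)) := by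
  have hk : (0 : ℝ) ≤ k := Nat.cast_nonneg k
  have hi : ∀ a b, IntervalIntegrable u volume a b := fun a b => hu.intervalIntegrable
  have hi' : IntervalIntegrable (fun r => u (r + k)) volume 1 R :=
    Monotone.intervalIntegrable fun a b hab => hu (by linarith)
  -- The integral telescopes to the integral over `[R, R + k]` minus a nonnegative one over `[1, 1 +
  -- k]`. Markov's inequality then bounds the measure.
  have hI : ∫ r in (1 : ℝ)..R, (u (r + k) - u r) ≤ k * u (R + k) := by
    rw [intervalIntegral.integral_sub hi' (hi _ _), intervalIntegral.integral_comp_add_right]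
    have h1 := intervalIntegral.integral_interval_sub_interval_comm (hi (1 + k) (R + k))
      (hi 1 R) (hi (1 + k) 1)
    rw [h1]
    have h2 : 0 ≤ ∫ r in (1 : ℝ)..(1 + k), u r :=
      intervalIntegral.integral_nonneg (by linarith) fun r _ => h0 r
    have h3 : ∫ r in R..(R + k), u r ≤ ∫ r in R..(R + k), u (R + k) :=
      intervalIntegral.integral_mono_on (by linarith) (hi _ _) intervalIntegrable_const
        fun r hr => hu hr.2
    rw [intervalIntegral.integral_const, smul_eq_mul, add_sub_cancel_left] at h3
    rw [intervalIntegral.integral_symm 1 (1 + (k : ℝ)),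
      intervalIntegral.integral_symm R (R + (k : ℝ))]
    linarith
  have hint : Integrable (fun r => u (r + k) - u r) (volume.restrict (Set.Icc 1 R)) := by
    have := (intervalIntegrable_iff_integrableOn_Icc_of_le hR).1 (hi'.sub (hi 1 R))
    exact this
  have hM := mul_meas_ge_le_integral_of_nonneg (μ := volume.restrict (Set.Icc 1 R))
    (Eventually.of_forall fun r => sub_nonneg.2 (hu (by linarith : r ≤ r + k))) hint 1
  rw [one_mul, integral_Icc_eq_integral_Ioc, ← intervalIntegral.integral_of_le hR] at hM
  have hmeas : MeasurableSet {r | 1 < u (r + k) - u r} :=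
    measurableSet_lt measurable_const
      ((hu.measurable.comp (measurable_id.add_const _)).sub hu.measurable)
  have hfin : (volume.restrict (Set.Icc 1 R)) {r | 1 ≤ u (r + k) - u r} ≠ ∞ :=
    measure_ne_top _ _
  rw [← Measure.restrict_apply hmeas]
  have hsub : {r | 1 < u (r + k) - u r} ⊆ {r | 1 ≤ u (r + k) - u r} :=
    fun r (hr : 1 < u (r + k) - u r) => hr.le
  refine (measure_mono hsub).trans ?_
  rw [← ENNReal.ofReal_toReal hfin]
  exact ENNReal.ofReal_le_ofReal (hM.trans hI)

/-- A monotone function of sublinear growth has small increments outside a set of zero upper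
density. -/
theorem exists_zeroUpperDensity_increment_le {u : ℝ → ℝ} (hu : Monotone u) (h0 : ∀ r, 0 ≤ u r)
    (hgrowth : ∀ ε > 0, ∀ᶠ r in atTop, u r ≤ ε * r) :
    ∃ E : Set ℝ, MeasurableSet E ∧ ZeroUpperDensity E ∧
      ∀ k : ℕ, ∀ᶠ r in atTop, r ∉ E → u (r + k) - u r ≤ 1 := by
  obtain ⟨E, hE, hE0, h⟩ := exists_zeroUpperDensity_of_monotone
    (E := fun k : ℕ => {r | 1 < u (r + k) - u r})
    (fun k => measurableSet_lt measurable_const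
      ((hu.measurable.comp (measurable_id.add_const _)).sub hu.measurable))
    (fun k l hkl r hr => by
      have : (k : ℝ) ≤ l := Nat.cast_le.2 hkl
      have := hu (by linarith : r + k ≤ r + l)
      simp only [Set.mem_ofPred_eq] at hr ⊢
      linarith)
    (fun k ε hε => by
      -- For `R ≥ k` one has `R + k ≤ 2 * R`, and this constant then absorbs both the `2` and the
      -- factor `k`.
      have hε' : 0 < ε / (2 * (k + 1)) := by positivity
      have htend : Tendsto (fun R : ℝ => R + k) atTop atTop :=
        tendsto_atTop_add_const_right _ _ tendsto_id
      filter_upwards [htend.eventually (hgrowth _ hε'), eventually_ge_atTop 1,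
        eventually_ge_atTop (k : ℝ)] with R hR hR1 hRk
      refine (volume_increment_le hu h0 k hR1).trans (ENNReal.ofReal_le_ofReal ?_)
      have hk : (0 : ℝ) ≤ k := Nat.cast_nonneg k
      calc (k : ℝ) * u (R + k) ≤ (k + 1) * (ε / (2 * (k + 1)) * (2 * R)) := by
            refine mul_le_mul (by linarith) (hR.trans ?_) (h0 _) (by linarith)
            exact mul_le_mul_of_nonneg_left (by linarith) hε'.le
        _ = ε * R := by field_simp)
  exact ⟨E, hE, hE0, fun k => (h k).mono fun r hr hrE => not_lt.1 (hr hrE)⟩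

theorem SubnormalGrowth.eventually_log_le {T : ℝ → ℝ} (hT : SubnormalGrowth T) {ε : ℝ}
    (hε : 0 < ε) : ∀ᶠ r in atTop, Real.log (T r) ≤ ε * r := by
  have h : limsup (fun r : ℝ => ((Real.log (T r) / r : ℝ) : EReal)) atTop < (ε : EReal) := by
    rw [hT]; exact_mod_cast hε
  filter_upwards [eventually_lt_of_limsup_lt h, eventually_gt_atTop 0] with r hr hr0
  have := EReal.coe_lt_coe_iff.1 hr
  exact ((div_lt_iff₀ hr0).1 this).le

/-- A function of subnormal growth is comparable with its shifts outside a set of zero upper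
density. -/
theorem exists_zeroUpperDensity_shift_le {T : ℝ → ℝ} (hmono : MonotoneOn T (Set.Ici 0))
    (h0 : ∀ r, 0 ≤ T r) (htop : Tendsto T atTop atTop) (hT : SubnormalGrowth T) :
    ∃ E : Set ℝ, MeasurableSet E ∧ ZeroUpperDensity E ∧
      ∀ k : ℕ, ∀ᶠ r in atTop, r ∉ E → T (r + k) ≤ 6 * T r := by
  have hpos : ∀ r, 0 < 1 + T r := fun r => by linarith [h0 r]
  obtain ⟨E, hE, hE0, h⟩ := exists_zeroUpperDensity_increment_le
    -- Adding `1` makes the logarithm nonnegative; `max r 0` extends the monotonicity from `[0, ∞)`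
    -- to the line.
    (u := fun r => Real.log (1 + T (max r 0)))
    (fun r s hrs => Real.log_le_log (hpos _) (by
      have := hmono (le_max_right r 0) (le_max_right s 0) (max_le_max_right 0 hrs)
      linarith))
    (fun r => Real.log_nonneg (by linarith [h0 (max r 0)]))
    (fun ε hε => by
      filter_upwards [hT.eventually_log_le (half_pos hε), htop.eventually_ge_atTop 1,
        eventually_ge_atTop 0, eventually_ge_atTop (2 * Real.log 2 / ε)] with r h1 h2 h3 h4
      rw [max_eq_left h3]
      have h5 : Real.log (1 + T r) ≤ Real.log (2 * T r) :=
        Real.log_le_log (hpos r) (by linarith)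
      rw [Real.log_mul (by norm_num) (by linarith)] at h5
      rw [div_le_iff₀ hε] at h4
      linarith)
  refine ⟨E, hE, hE0, fun k => ?_⟩
  filter_upwards [h k, htop.eventually_ge_atTop 1, eventually_ge_atTop 0] with r hr h1 h2 hrE
  have h3 := hr hrE
  have hk : (0 : ℝ) ≤ k := Nat.cast_nonneg k
  rw [max_eq_left h2, max_eq_left (by linarith), ← Real.log_div (hpos _).ne' (hpos _).ne',
    Real.log_le_iff_le_exp (div_pos (hpos _) (hpos _)), div_le_iff₀ (hpos _)] at h3
  -- An increment of the logarithm by at most `1` gives `1 + T (r + k) ≤ e (1 + T r) ≤ 3 (1 + T r)`,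
  -- and `T r ≥ 1` leaves the factor `6`.
  have h4 := Real.exp_one_lt_d9
  have h5 : Real.exp 1 * (1 + T r) ≤ 3 * (1 + T r) :=
    mul_le_mul_of_nonneg_right (by linarith) (hpos r).le
  linarith

end Growth

/-! ### Means over shifted spheres -/

section ShiftedMean

open scoped NNReal

variable {n : ℕ} {g : Space n → ℝ}

/-- The mean of `g` over the sphere of radius `r` centred at `v`. -/
def shiftedMean (g : Space n → ℝ) (r : ℝ) (v : Space n) : ℝ :=
  ∫ θ, g (r • (θ : Space n) + v) ∂sphereProb n

theorem integrable_shifted [Nontrivial (Space n)] (hg : Continuous g) (r : ℝ) (v : Space n) :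
    Integrable (fun θ : Metric.sphere (0 : Space n) 1 => g (r • (θ : Space n) + v))
      (sphereProb n) :=
  integrable_sphereProb (by fun_prop)

theorem integral_inner_sphereProb (m : Space n) :
    ∫ θ : Metric.sphere (0 : Space n) 1, inner ℝ m (θ : Space n) ∂sphereProb n = 0 := by
  have h := integral_sphereProb_neg (fun x : Space n => inner ℝ m x)
  simp only [inner_neg_right, integral_neg] at h
  linarith

/-- The linear part is odd on the sphere and averages to zero, so only the value at the centre `v`
survives. This permits normalising by a supporting affine function. -/
theorem shiftedMean_add_affine [Nontrivial (Space n)] (hg : Continuous g) (m : Space n) (b r : ℝ)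
    (v : Space n) :
    shiftedMean (fun x => g x + (b + inner ℝ m x)) r v =
      shiftedMean g r v + (b + inner ℝ m v) := by
  have i1 := integrable_shifted hg r v
  have i2 : Integrable (fun θ : Metric.sphere (0 : Space n) 1 =>
      r * inner ℝ m (θ : Space n)) (sphereProb n) := integrable_sphereProb (by fun_prop)
  have h : ∀ θ : Metric.sphere (0 : Space n) 1, g (r • (θ : Space n) + v) +
      (b + inner ℝ m (r • (θ : Space n) + v)) =
      g (r • (θ : Space n) + v) + (r * inner ℝ m (θ : Space n) + (b + inner ℝ m v)) := fun θ => by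
    rw [inner_add_right, inner_smul_right]; ring
  have i3 : Integrable (fun θ : Metric.sphere (0 : Space n) 1 =>
      r * inner ℝ m (θ : Space n) + (b + inner ℝ m v)) (sphereProb n) :=
    i2.add (integrable_const _)
  rw [shiftedMean, integral_congr_ae (Eventually.of_forall h), integral_add i1 i3,
    integral_add i2 (integrable_const _), integral_const_mul, integral_inner_sphereProb]
  simp [shiftedMean]

theorem map_smul_le_of_convexOn (hg : ConvexOn ℝ Set.univ g) (h0 : g 0 = 0) {a : ℝ} (ha : 0 ≤ a)
    (ha1 : a ≤ 1) (x : Space n) : g (a • x) ≤ a * g x := by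
  have := hg.2 (Set.mem_univ x) (Set.mem_univ 0) ha (sub_nonneg.2 ha1) (by ring)
  simpa [h0] using this

theorem map_smul_le_div_mul (hg : ConvexOn ℝ Set.univ g) (h0 : g 0 = 0) {s t : ℝ} (hs : 0 ≤ s)
    (hst : s ≤ t) (ht : 0 < t) (x : Space n) : g (s • x) ≤ s / t * g (t • x) := by
  have h := map_smul_le_of_convexOn hg h0 (div_nonneg hs ht.le) ((div_le_one ht).2 hst) (t • x)
  rwa [smul_smul, div_mul_cancel₀ _ ht.ne'] at h

theorem map_smul_mono (hg : ConvexOn ℝ Set.univ g) (h0 : g 0 = 0) (hpos : ∀ x, 0 ≤ g x)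
    {s t : ℝ} (hs : 0 ≤ s) (hst : s ≤ t) (x : Space n) : g (s • x) ≤ g (t • x) := by
  rcases hs.eq_or_lt with rfl | hs'
  · rw [zero_smul, h0]; exact hpos _
  have ht : 0 < t := hs'.trans_le hst
  refine (map_smul_le_div_mul hg h0 hs hst ht x).trans ?_
  exact mul_le_of_le_one_left (hpos _) ((div_le_one ht).2 hst)

theorem shiftedMean_nonneg (hpos : ∀ x, 0 ≤ g x) (r : ℝ) (v : Space n) :
    0 ≤ shiftedMean g r v :=
  integral_nonneg fun _ => hpos _

theorem shiftedMean_zero_mono [Nontrivial (Space n)] (hg : ConvexOn ℝ Set.univ g) (h0 : g 0 = 0)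
    (hpos : ∀ x, 0 ≤ g x) : MonotoneOn (fun r => shiftedMean g r 0) (Set.Ici 0) := by
  intro s hs t _ hst
  have hc : Continuous g := hg.locallyLipschitz.continuous
  refine integral_mono (integrable_shifted hc s 0) (integrable_shifted hc t 0) fun θ => ?_
  simpa using map_smul_mono hg h0 hpos hs hst (θ : Space n)

theorem tendsto_shiftedMean_zero [Nontrivial (Space n)] (hg : ConvexOn ℝ Set.univ g)
    (h0 : g 0 = 0) (hpos : ∀ x, 0 ≤ g x) (hne : ∃ x, g x ≠ 0) :
    Tendsto (fun r => shiftedMean g r 0) atTop atTop := by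
  have hc : Continuous g := hg.locallyLipschitz.continuous
  obtain ⟨x, hx⟩ := hne
  have hx0 : x ≠ 0 := fun h => hx (by rw [h, h0])
  have hs : 0 < ‖x‖ := norm_pos_iff.2 hx0
  have hκ : 0 < shiftedMean g ‖x‖ 0 := by
    let θ₀ : Metric.sphere (0 : Space n) 1 := ⟨‖x‖⁻¹ • x, by
      rw [mem_sphere_zero_iff_norm, norm_smul, norm_inv, norm_norm, inv_mul_cancel₀ hs.ne']⟩
    -- The mean is positive because the integrand is continuous, nonnegative and nonzero at `θ₀`,
    -- and open sets of the sphere have positive measure.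
    refine integral_pos_of_integrable_nonneg_nonzero (x := θ₀) (by fun_prop)
      (integrable_shifted hc _ _) (fun θ => hpos _) ?_
    simpa [θ₀, smul_smul, mul_inv_cancel₀ hs.ne'] using hx
  have hlim : Tendsto (fun r : ℝ => r * (shiftedMean g ‖x‖ 0 / ‖x‖)) atTop atTop :=
    tendsto_id.atTop_mul_const (div_pos hκ hs)
  refine tendsto_atTop_mono' _ ?_ hlim
  filter_upwards [eventually_ge_atTop ‖x‖] with r hr
  have hr0 : 0 < r := hs.trans_le hr
  -- Convexity with `g 0 = 0` makes `g` grow at least linearly along rays, hence so does the mean.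
  have h1 : shiftedMean g ‖x‖ 0 ≤ ‖x‖ / r * shiftedMean g r 0 := by
    rw [shiftedMean, shiftedMean, ← integral_const_mul]
    refine integral_mono (integrable_shifted hc _ 0) ((integrable_shifted hc r 0).const_mul _)
      fun θ => ?_
    simpa using map_smul_le_div_mul hg h0 hs.le hr hr0 (θ : Space n)
  calc r * (shiftedMean g ‖x‖ 0 / ‖x‖)
      ≤ r * ((‖x‖ / r * shiftedMean g r 0) / ‖x‖) := by gcongr
    _ = shiftedMean g r 0 := by field_simp

/-- The mean of a nonnegative convex function over a slightly shifted sphere is controlled by its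
mean over a slightly larger centred sphere. -/
theorem exists_shiftedMean_le (n : ℕ) [Nontrivial (Space n)] :
    ∃ C : ℝ, 0 ≤ C ∧ ∀ g : Space n → ℝ, ConvexOn ℝ Set.univ g → g 0 = 0 → (∀ x, 0 ≤ g x) →
      ∀ (r : ℝ) (v : Space n), 0 < r → ‖v‖ ≤ r / 2 →
        shiftedMean g r v ≤ C * shiftedMean g (r + ‖v‖) 0 := by
  obtain ⟨C, hC⟩ := exists_map_shiftDir_le n
  refine ⟨C, C.2, fun g hg h0 hpos r v hr hv => ?_⟩
  have hc : Continuous g := hg.locallyLipschitz.continuous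
  have hwn : ‖r⁻¹ • v‖ = ‖v‖ / r := by
    rw [norm_smul, norm_inv, Real.norm_of_nonneg hr.le]; field_simp
  have hw : ‖r⁻¹ • v‖ ≤ 1 / 2 := by
    rw [hwn, div_le_iff₀ hr]; linarith
  have hψ := continuous_shiftDir hw
  have hF : Continuous fun φ : Metric.sphere (0 : Space n) 1 => g ((r + ‖v‖) • (φ : Space n)) := by
    fun_prop
  calc shiftedMean g r v
      ≤ ∫ θ, g ((r + ‖v‖) • (shiftDir _ hw θ : Space n)) ∂sphereProb n := by
        refine integral_mono (integrable_shifted hc r v)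
          (integrable_sphereProb (hF.comp hψ)) fun θ => ?_
        -- The shifted point lies on the ray through `shiftDir` at distance at most `r + ‖v‖`, and
        -- `g` increases along rays.
        have h1 : r • (θ : Space n) + v =
            (r * ‖(θ : Space n) + r⁻¹ • v‖) • (shiftDir _ hw θ : Space n) := by
          rw [mul_smul, norm_smul_shiftDir, smul_add, smul_smul, mul_inv_cancel₀ hr.ne', one_smul]
        simp only [h1]
        refine map_smul_mono hg h0 hpos (by positivity) ?_ _
        have h2 := mul_le_mul_of_nonneg_left (norm_add_le_of_sphere (r⁻¹ • v) θ) hr.le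
        rw [hwn, mul_add, mul_one, mul_div_cancel₀ _ hr.ne'] at h2
        exact h2
    _ = ∫ φ, g ((r + ‖v‖) • (φ : Space n)) ∂(sphereProb n).map (shiftDir _ hw) :=
        (integral_map hψ.measurable.aemeasurable hF.aestronglyMeasurable).symm
    _ ≤ ∫ φ, g ((r + ‖v‖) • (φ : Space n)) ∂(C • sphereProb n) :=
        integral_mono_measure (hC _ hw) (Eventually.of_forall fun φ => hpos _)
          ((integrable_sphereProb hF).smul_measure_nnreal)
    _ = C * shiftedMean g (r + ‖v‖) 0 := by
        rw [integral_smul_nnreal_measure]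
        simp [shiftedMean, NNReal.smul_def]

/-- `x + v` is the convex combination of `x + L • v` and `x` with weight `L⁻¹` on the former; the
leftover `-L⁻¹ * g x` is dropped by nonnegativity. -/
theorem sub_le_div_of_convexOn (hg : ConvexOn ℝ Set.univ g) (hpos : ∀ x, 0 ≤ g x) {L : ℝ}
    (hL : 1 ≤ L) (x v : Space n) : g (x + v) - g x ≤ L⁻¹ * g (x + L • v) := by
  have hL0 : 0 < L := by linarith
  have hLi : L⁻¹ ≤ 1 := inv_le_one_of_one_le₀ hL
  have h := hg.2 (Set.mem_univ (x + L • v)) (Set.mem_univ x) (inv_nonneg.2 hL0.le)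
    (sub_nonneg.2 hLi) (by ring)
  have hx : L⁻¹ • (x + L • v) + (1 - L⁻¹) • x = x + v := by
    rw [smul_add, smul_smul, inv_mul_cancel₀ hL0.ne', one_smul]
    module
  rw [hx, smul_eq_mul, smul_eq_mul] at h
  have := mul_nonneg (inv_nonneg.2 hL0.le) (hpos x)
  linarith

theorem abs_sub_shiftedMean_le [Nontrivial (Space n)] {C : ℝ}
    (hC : ∀ g : Space n → ℝ, ConvexOn ℝ Set.univ g → g 0 = 0 → (∀ x, 0 ≤ g x) →
      ∀ (r : ℝ) (v : Space n), 0 < r → ‖v‖ ≤ r / 2 →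
        shiftedMean g r v ≤ C * shiftedMean g (r + ‖v‖) 0)
    (hg : ConvexOn ℝ Set.univ g) (h0 : g 0 = 0) (hpos : ∀ x, 0 ≤ g x) {r L : ℝ} (hL : 1 ≤ L)
    {v : Space n} (hr : 0 < r) (hv : L * ‖v‖ ≤ r / 2) :
    |shiftedMean g r v - shiftedMean g r 0| ≤ L⁻¹ * (C * shiftedMean g (r + L * ‖v‖) 0) := by
  have hc : Continuous g := hg.locallyLipschitz.continuous
  have hL0 : 0 < L := by linarith
  have hup : ∀ v : Space n, L * ‖v‖ ≤ r / 2 →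
      shiftedMean g r v - shiftedMean g r 0 ≤ L⁻¹ * (C * shiftedMean g (r + L * ‖v‖) 0) := by
    intro v hv
    have hn : ‖L • v‖ = L * ‖v‖ := by rw [norm_smul, Real.norm_of_nonneg hL0.le]
    have h1 := hC g hg h0 hpos r (L • v) hr (by rwa [hn])
    rw [hn] at h1
    refine le_trans ?_ (mul_le_mul_of_nonneg_left h1 (inv_nonneg.2 hL0.le))
    simp only [shiftedMean]
    rw [← integral_sub (integrable_shifted hc r v) (integrable_shifted hc r 0),
      ← integral_const_mul]
    refine integral_mono ((integrable_shifted hc r v).sub (integrable_shifted hc r 0))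
      ((integrable_shifted hc r (L • v)).const_mul _) fun θ => ?_
    simpa using sub_le_div_of_convexOn hg hpos hL (r • (θ : Space n)) v
  refine abs_le.2 ⟨?_, hup v hv⟩
  have h2 := hup (-v) (by rwa [norm_neg])
  rw [norm_neg] at h2
  -- Midpoint convexity makes the means at `v` and `-v` add up to at least twice the centred one, so
  -- the upper bound for `-v` yields the lower bound for `v`.
  have h3 : 2 * shiftedMean g r 0 ≤ shiftedMean g r v + shiftedMean g r (-v) := by
    simp only [shiftedMean]
    rw [← integral_add (integrable_shifted hc r v) (integrable_shifted hc r (-v)),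
      ← integral_const_mul]
    refine integral_mono ((integrable_shifted hc r 0).const_mul _)
      ((integrable_shifted hc r v).add (integrable_shifted hc r (-v))) fun θ => ?_
    have h := hg.2 (Set.mem_univ (r • (θ : Space n) + v)) (Set.mem_univ (r • (θ : Space n) + -v))
      (by norm_num : (0 : ℝ) ≤ 1 / 2) (by norm_num : (0 : ℝ) ≤ 1 / 2) (by norm_num)
    have hx : (1 / 2 : ℝ) • (r • (θ : Space n) + v) + (1 / 2 : ℝ) • (r • (θ : Space n) + -v) =
        r • (θ : Space n) := by module
    rw [hx, smul_eq_mul, smul_eq_mul] at h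
    simp only [add_zero]
    linarith
  linarith

/-- For a nonnegative convex function of subnormal growth, shifting the sphere changes the mean by
a negligible amount outside a set of zero upper density. -/
theorem exists_isLittleO_shiftedMean_sub [Nontrivial (Space n)] (hg : ConvexOn ℝ Set.univ g)
    (h0 : g 0 = 0) (hpos : ∀ x, 0 ≤ g x)
    (htop : Tendsto (fun r => shiftedMean g r 0) atTop atTop)
    (hT : SubnormalGrowth fun r => shiftedMean g r 0) :
    ∃ E : Set ℝ, MeasurableSet E ∧ ZeroUpperDensity E ∧ ∀ v : Space n,
      (fun r => shiftedMean g r v - shiftedMean g r 0) =o[atTop ⊓ 𝓟 Eᶜ]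
        fun r => shiftedMean g r 0 := by
  obtain ⟨C, hC0, hC⟩ := exists_shiftedMean_le n
  have hmono := shiftedMean_zero_mono hg h0 hpos
  obtain ⟨E, hE, hE0, h⟩ := exists_zeroUpperDensity_shift_le hmono
    (fun r => shiftedMean_nonneg hpos r 0) htop hT
  refine ⟨E, hE, hE0, fun v => isLittleO_iff.2 fun ε hε => ?_⟩
  rw [eventually_inf_principal]
  -- `L` is chosen so that `6 * C / L ≤ ε`. Both `L` and `k` depend on `ε` and `v`, but `E` does
  -- not, since it serves every `k`.
  obtain ⟨L, hL1, hLε⟩ : ∃ L : ℝ, 1 ≤ L ∧ 6 * C / ε ≤ L :=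
    ⟨max 1 (6 * C / ε), le_max_left _ _, le_max_right _ _⟩
  have hL0 : 0 < L := by linarith
  obtain ⟨k, hk⟩ := exists_nat_ge (L * ‖v‖)
  filter_upwards [h k, eventually_gt_atTop 0, eventually_ge_atTop (2 * (L * ‖v‖))]
    with r hr hr0 hrL hrE
  rw [Real.norm_eq_abs, Real.norm_of_nonneg (shiftedMean_nonneg hpos r 0)]
  have hLv : 0 ≤ L * ‖v‖ := by positivity
  have hT0 := shiftedMean_nonneg hpos r 0
  have h1 : shiftedMean g (r + L * ‖v‖) 0 ≤ 6 * shiftedMean g r 0 :=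
    (hmono (by simp; linarith) (by simp; linarith) (by linarith)).trans (hr hrE)
  refine (abs_sub_shiftedMean_le hC hg h0 hpos hL1 hr0 (by linarith)).trans ?_
  rw [inv_mul_le_iff₀ hL0]
  rw [div_le_iff₀ hε] at hLε
  calc C * shiftedMean g (r + L * ‖v‖) 0 ≤ C * (6 * shiftedMean g r 0) := by gcongr
    _ = 6 * C * shiftedMean g r 0 := by ring
    _ ≤ L * ε * shiftedMean g r 0 := by gcongr
    _ = _ := by ring

end ShiftedMean

/-! ### The second main theorem -/

section Main

variable {n : ℕ}

theorem Trop.toEReal_coe (t : ℝ) : Trop.toEReal (t : Trop) = (t : EReal) := rfl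

theorem Trop.toEReal_bot : Trop.toEReal ⊥ = ⊥ := rfl

theorem ProjLine.mk_coe_coe (s t : ℝ) :
    ProjLine.mk (s : Trop) (t : Trop) = ((t - s : ℝ) : EReal) := rfl

theorem ProjLine.mk_bot_right (x : Trop) : ProjLine.mk x ⊥ = ⊥ := by
  rw [ProjLine.mk, Trop.toEReal_bot, EReal.bot_sub]

theorem ProjLine.mk_bot_coe (t : ℝ) : ProjLine.mk ⊥ (t : Trop) = ⊤ := by
  rw [ProjLine.mk, Trop.toEReal_bot, Trop.toEReal_coe, EReal.coe_sub_bot]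

theorem rootCounting_coe [Nontrivial (Space n)] {p : Space n → ℝ} (hp : IsRealEntire p)
    {P : Space n → Trop} (hP : ∀ x, P x = (p x : Trop)) {r : ℝ} (hr : 0 ≤ r) :
    rootCounting r P = shiftedMean p r 0 - p 0 := by
  have : (fun x => -(P x).toReal) = fun x => -p x := by
    funext x; rw [hP]; rfl
  rw [rootCounting, this, counting_neg hp hr]
  simp [shiftedMean]

theorem abs_shiftedMean_sub_le [Nontrivial (Space n)] {p h : Space n → ℝ} (hp : Continuous p)
    (hh : Continuous h) {B : ℝ} (hB : ∀ x, |p x - h x| ≤ B) (r : ℝ) (v : Space n) :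
    |shiftedMean p r v - shiftedMean h r v| ≤ B := by
  simp only [shiftedMean]
  rw [← integral_sub (integrable_shifted hp r v) (integrable_shifted hh r v)]
  have := norm_integral_le_of_norm_le_const (μ := sphereProb n)
    (f := fun θ => p (r • (θ : Space n) + v) - h (r • (θ : Space n) + v))
    (Eventually.of_forall fun θ => hB (r • (θ : Space n) + v))
  simpa using this

theorem abs_sup_add_sub_sup_le (b₀ b₁ s t : ℝ) :
    |max (b₀ + s) (b₁ + t) - max s t| ≤ max |b₀| |b₁| := by
  have := abs_max_sub_max_le_max (b₀ + s) (b₁ + t) s t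
  simpa using this

theorem linComp_coe {g₀ g₁ : Space n → ℝ} {f₀ f₁ : Space n → Trop}
    (h₀ : ∀ x, f₀ x = (g₀ x : Trop)) (h₁ : ∀ x, f₁ x = (g₁ x : Trop)) (b₀ b₁ : ℝ) (x : Space n) :
    linComp (b₀ : Trop) (b₁ : Trop) f₀ f₁ x = ((max (b₀ + g₀ x) (b₁ + g₁ x) : ℝ) : Trop) := by
  rw [linComp, h₀, h₁]
  rfl

theorem casorati_two_coe {p₁ p₂ : Space n → ℝ} {P₁ P₂ : Space n → Trop}
    (h₁ : ∀ x, P₁ x = (p₁ x : Trop)) (h₂ : ∀ x, P₂ x = (p₂ x : Trop)) (c x : Space n) :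
    casorati c ![P₁, P₂] x =
      ((max (p₁ x + p₂ (x + c)) (p₁ (x + c) + p₂ x) : ℝ) : Trop) := by
  have huniv : (Finset.univ : Finset (Equiv.Perm (Fin 2))) = {1, Equiv.swap 0 1} := by decide
  rw [casorati, huniv, Finset.sup_insert, Finset.sup_singleton]
  simp [Fin.sum_univ_two, h₁, h₂]

/-- The number of roots of a function within bounded distance of `h` is asymptotically the mean
of `h`. -/
theorem rootCounting_sub_isLittleO [Nontrivial (Space n)] {p h : Space n → ℝ}
    (hp : IsRealEntire p) (hh : Continuous h) {P : Space n → Trop} (hP : ∀ x, P x = (p x : Trop))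
    {B : ℝ} (hB : ∀ x, |p x - h x| ≤ B) {l : Filter ℝ} (hl : l ≤ atTop) {T : ℝ → ℝ}
    (hT : Tendsto T l atTop) :
    (fun r => rootCounting r P - shiftedMean h r 0) =o[l] T := by
  have hone : (fun _ : ℝ => (1 : ℝ)) =o[l] T :=
    (isLittleO_const_left.2 (Or.inr (tendsto_norm_atTop_atTop.comp hT)))
  refine IsBigO.trans_isLittleO (IsBigO.of_bound (B + |p 0|) ?_) hone
  filter_upwards [hl (eventually_ge_atTop (0 : ℝ))] with r hr
  rw [rootCounting_coe hp hP hr, norm_one, mul_one, Real.norm_eq_abs]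
  have h1 := abs_shiftedMean_sub_le hp.continuous hh hB r 0
  calc |shiftedMean p r 0 - p 0 - shiftedMean h r 0|
      = |(shiftedMean p r 0 - shiftedMean h r 0) - p 0| := by congr 1; ring
    _ ≤ _ := (abs_sub _ _).trans (by linarith)

theorem cartanChar_coe {g₀ g₁ : Space n → ℝ} {f₀ f₁ : Space n → Trop}
    (h₀ : ∀ x, f₀ x = (g₀ x : Trop)) (h₁ : ∀ x, f₁ x = (g₁ x : Trop)) (r : ℝ) :
    cartanChar f₀ f₁ r = shiftedMean (fun x => max (g₀ x) (g₁ x)) r 0 - max (g₀ 0) (g₁ 0) := by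
  have h : ∀ x, (f₀ x ⊔ f₁ x).toReal = max (g₀ x) (g₁ x) := fun x => by
    rw [h₀, h₁, ← WithBot.coe_sup]; rfl
  simp [cartanChar, h, sphereMean_eq, shiftedMean]

theorem exists_real_representatives {f₀ f₁ : Space n → Trop} (hf₀ : IsEntire f₀)
    (hf₁ : IsEntire f₁) {f : Space n → ProjLine} (hf : ∀ x, f x = ProjLine.mk (f₀ x) (f₁ x))
    (hnonconst : ¬ ∃ b : ProjLine, ∀ x, f x = b) :
    ∃ g₀ g₁ : Space n → ℝ, IsRealEntire g₀ ∧ IsRealEntire g₁ ∧ (∀ x, f₀ x = (g₀ x : Trop)) ∧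
      ∀ x, f₁ x = (g₁ x : Trop) := by
  rcases hf₁.eq_bot_or_real with h₁ | ⟨g₁, hg₁, h₁⟩
  · exact absurd ⟨⊥, fun x => by rw [hf, h₁, ProjLine.mk_bot_right]⟩ hnonconst
  rcases hf₀.eq_bot_or_real with h₀ | ⟨g₀, hg₀, h₀⟩
  · exact absurd ⟨⊤, fun x => by rw [hf, h₀, h₁, ProjLine.mk_bot_coe]⟩ hnonconst
  exact ⟨g₀, g₁, hg₀, hg₁, h₀, h₁⟩

/-- If `a₀ = ⊥`, then `a = -∞` and `f ⊕ a = f`; if only `a₁ = ⊥`, then `a = +∞` and `f ⊕ a = a`.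
Both are excluded. -/
theorem exists_real_coefficients {f : Space n → ProjLine} {a₀ a₁ : Trop} {a : ProjLine}
    (hne : ¬ (a₀ = ⊥ ∧ a₁ = ⊥)) (ha : a = ProjLine.mk a₁ a₀)
    (hfa : (¬ ∀ x, f x = f x ⊔ a) ∧ ¬ ∀ x, f x ⊔ a = a) :
    ∃ b₀ b₁ : ℝ, a₀ = (b₀ : Trop) ∧ a₁ = (b₁ : Trop) := by
  induction a₀ using WithBot.recBotCoe with
  | bot =>
    rw [ProjLine.mk_bot_right] at ha
    exact absurd (fun x => by rw [ha, sup_bot_eq]) hfa.1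
  | coe b₀ =>
    induction a₁ using WithBot.recBotCoe with
    | bot =>
      rw [ProjLine.mk_bot_coe] at ha
      exact absurd (fun x => by rw [ha, sup_top_eq]) hfa.2
    | coe b₁ => exact ⟨b₀, b₁, rfl, rfl⟩

/-- The maximum of two tropical entire functions with nonconstant quotient is not affine. -/
theorem sup_ne_affine {g₀ g₁ : Space n → ℝ} (hg₀ : IsRealEntire g₀) (hg₁ : IsRealEntire g₁)
    (hne : ¬ ∃ b : ℝ, ∀ x, g₁ x - g₀ x = b) (m : Space n) (b : ℝ) :
    ∃ x, max (g₀ x) (g₁ x) ≠ b + inner ℝ m x := by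
  by_contra! hcon
  obtain ⟨b₀, h₀⟩ := hg₀.eq_affine_of_le fun x => (le_max_left _ _).trans (hcon x).le
  obtain ⟨b₁, h₁⟩ := hg₁.eq_affine_of_le fun x => (le_max_right _ _).trans (hcon x).le
  exact hne ⟨b₁ - b₀, fun x => by rw [h₀, h₁]; ring⟩

/-- The mean of a nonaffine tropical entire function of subnormal growth tends to infinity, and
shifting the sphere changes it negligibly outside a set of zero upper density. -/
theorem IsRealEntire.exists_isLittleO_shiftedMean_sub [Nontrivial (Space n)] {h : Space n → ℝ}
    (hh : IsRealEntire h) (hne : ∀ (m : Space n) (b : ℝ), ∃ x, h x ≠ b + inner ℝ m x)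
    (hT : SubnormalGrowth fun r => shiftedMean h r 0 - h 0) :
    Tendsto (fun r => shiftedMean h r 0 - h 0) atTop atTop ∧
    ∃ E : Set ℝ, MeasurableSet E ∧ ZeroUpperDensity E ∧ ∀ v : Space n,
      (fun r => shiftedMean h r v - shiftedMean h r 0) =o[atTop ⊓ 𝓟 Eᶜ]
        fun r => shiftedMean h r 0 - h 0 := by
  obtain ⟨m, b, hle, heq⟩ := hh.exists_support 0
  rw [inner_zero_right, add_zero] at heq
  -- Subtracting the supporting function at `0` makes `g` nonnegative with `g 0 = 0`, without
  -- changing the characteristic.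
  set g : Space n → ℝ := fun x => h x + (-b + inner ℝ (-m) x)
  have hg : ConvexOn ℝ Set.univ g := (hh.add (isRealEntire_affine (-m) (-b))).convexOn
  have hg0 : g 0 = 0 := by simp [g, heq]
  have hpos : ∀ x, 0 ≤ g x := fun x => by
    have := hle x
    simp only [g, inner_neg_left]
    linarith
  have hmean : ∀ r v, shiftedMean g r v = shiftedMean h r v + (-b + inner ℝ (-m) v) :=
    fun r v => shiftedMean_add_affine hh.continuous (-m) (-b) r v
  have hTg : (fun r => shiftedMean h r 0 - h 0) = fun r => shiftedMean g r 0 := by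
    funext r
    rw [hmean, heq, inner_zero_right]
    ring
  have hgne : ∃ x, g x ≠ 0 := by
    obtain ⟨x, hx⟩ := hne m b
    refine ⟨x, fun h0 => hx ?_⟩
    simp only [g, inner_neg_left] at h0
    linarith
  have htop := tendsto_shiftedMean_zero hg hg0 hpos hgne
  rw [hTg] at hT ⊢
  obtain ⟨E, hE, hE0, hlit⟩ := TropNevanlinna.exists_isLittleO_shiftedMean_sub hg hg0 hpos htop hT
  refine ⟨htop, E, hE, hE0, fun v => ?_⟩
  have hone : (fun _ : ℝ => inner ℝ m v) =o[atTop ⊓ 𝓟 Eᶜ] fun r => shiftedMean g r 0 :=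
    isLittleO_const_left.2 (Or.inr (tendsto_norm_atTop_atTop.comp (htop.mono_left inf_le_left)))
  refine ((hlit v).add hone).congr_left fun r => ?_
  rw [hmean, hmean, inner_zero_right, inner_neg_left]
  ring

theorem abs_casorati_sub_le {p₁ p₂ h : Space n → ℝ} {B₁ B₂ : ℝ} (h₁ : ∀ x, |p₁ x - h x| ≤ B₁)
    (h₂ : ∀ x, |p₂ x - h x| ≤ B₂) (c x : Space n) :
    |max (p₁ x + p₂ (x + c)) (p₁ (x + c) + p₂ x) - (h x + h (x + c))| ≤ B₁ + B₂ := by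
  have a1 := abs_le.1 (h₁ x)
  have a2 := abs_le.1 (h₁ (x + c))
  have a3 := abs_le.1 (h₂ x)
  have a4 := abs_le.1 (h₂ (x + c))
  refine abs_le.2 ⟨?_, ?_⟩
  · have := le_max_left (p₁ x + p₂ (x + c)) (p₁ (x + c) + p₂ x)
    linarith
  · have : max (p₁ x + p₂ (x + c)) (p₁ (x + c) + p₂ x) ≤ B₁ + B₂ + (h x + h (x + c)) :=
      max_le (by linarith) (by linarith)
    linarith

end Main
end TropNevanlinna
end

open TropNevanlinna in
theorem mainTheorem10 (n q : ℕ) (hq : 2 ≤ q)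
    (f₀ f₁ : TropNevanlinna.Space n → TropNevanlinna.Trop)
    (hf₀ : TropNevanlinna.IsEntire f₀) (hf₁ : TropNevanlinna.IsEntire f₁)
    (f : TropNevanlinna.Space n → TropNevanlinna.ProjLine)
    (hf : ∀ x, f x = TropNevanlinna.ProjLine.mk (f₀ x) (f₁ x))
    (hnonconst : ¬ ∃ b : TropNevanlinna.ProjLine, ∀ x, f x = b)
    (hgrowth : TropNevanlinna.SubnormalGrowth (TropNevanlinna.cartanChar f₀ f₁))
    (a₀ a₁ : ℕ → TropNevanlinna.Trop) (a : ℕ → TropNevanlinna.ProjLine)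
    (ha_ne : ∀ j ∈ Finset.Icc 1 q, ¬ (a₀ j = ⊥ ∧ a₁ j = ⊥))
    (ha : ∀ j ∈ Finset.Icc 1 q, a j = TropNevanlinna.ProjLine.mk (a₁ j) (a₀ j))
    (ha_distinct : ∀ i ∈ Finset.Icc 1 q, ∀ j ∈ Finset.Icc 1 q, a i = a j → i = j)
    (hfa : ∀ j ∈ Finset.Icc 1 q,
      (¬ ∀ x, f x = f x ⊔ a j) ∧ (¬ ∀ x, f x ⊔ a j = a j))
    (c : TropNevanlinna.Space n) (hc : c ≠ 0) :
    ∃ E : Set ℝ, MeasurableSet E ∧ TropNevanlinna.ZeroUpperDensity E ∧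
      (fun r : ℝ => ((q : ℝ) - 2) * TropNevanlinna.cartanChar f₀ f₁ r -
          (∑ j ∈ Finset.Icc 1 q,
              TropNevanlinna.rootCounting r (TropNevanlinna.linComp (a₀ j) (a₁ j) f₀ f₁) -
            TropNevanlinna.rootCounting r
              (TropNevanlinna.casorati c
                ![TropNevanlinna.linComp (a₀ 1) (a₁ 1) f₀ f₁,
                  TropNevanlinna.linComp (a₀ 2) (a₁ 2) f₀ f₁])))
        =o[atTop ⊓ 𝓟 Eᶜ] TropNevanlinna.cartanChar f₀ f₁ ∧
      (fun r : ℝ => ((q : ℝ) - 2) * TropNevanlinna.cartanChar f₀ f₁ r -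
          ∑ j ∈ Finset.Icc 3 q,
            TropNevanlinna.rootCounting r (TropNevanlinna.linComp (a₀ j) (a₁ j) f₀ f₁))
        =o[atTop ⊓ 𝓟 Eᶜ] TropNevanlinna.cartanChar f₀ f₁ := by
  -- A nonzero step forces `n ≥ 1`, so the unit sphere is nonempty and carries the normalised
  -- measure.
  have : Nontrivial (Space n) := ⟨c, 0, hc⟩
  obtain ⟨g₀, g₁, hg₀, hg₁, h₀, h₁⟩ := exists_real_representatives hf₀ hf₁ hf hnonconst
  set h : Space n → ℝ := fun x => max (g₀ x) (g₁ x)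
  have hh : IsRealEntire h := hg₀.sup hg₁
  have hchar : cartanChar f₀ f₁ = fun r => shiftedMean h r 0 - h 0 :=
    funext fun r => cartanChar_coe h₀ h₁ r
  have hne : ¬ ∃ b : ℝ, ∀ x, g₁ x - g₀ x = b := fun ⟨b, hb⟩ =>
    hnonconst ⟨(b : EReal), fun x => by rw [hf, h₀, h₁, ProjLine.mk_coe_coe, hb]⟩
  rw [hchar] at hgrowth ⊢
  obtain ⟨htop, E, hE, hE0, hshift⟩ :=
    hh.exists_isLittleO_shiftedMean_sub (sup_ne_affine hg₀ hg₁ hne) hgrowth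
  have hb : ∀ j ∈ Finset.Icc 1 q, ∃ b₀ b₁ : ℝ, a₀ j = (b₀ : Trop) ∧ a₁ j = (b₁ : Trop) :=
    fun j hj => exists_real_coefficients (ha_ne j hj) (ha j hj) (hfa j hj)
  choose! b₀ b₁ hb₀ hb₁ using hb
  set l : Filter ℝ := atTop ⊓ 𝓟 Eᶜ
  have hl : l ≤ atTop := inf_le_left
  have htop' := htop.mono_left hl
  have hconst : ∀ b : ℝ, (fun _ : ℝ => b) =o[l] fun r => shiftedMean h r 0 - h 0 := fun b =>
    isLittleO_const_left.2 (Or.inr (tendsto_norm_atTop_atTop.comp htop'))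
  let p : ℕ → Space n → ℝ := fun j x => max (b₀ j + g₀ x) (b₁ j + g₁ x)
  have hp : ∀ j, IsRealEntire (p j) := fun j => (hg₀.const_add _).sup (hg₁.const_add _)
  have hpP : ∀ j ∈ Finset.Icc 1 q, ∀ x, linComp (a₀ j) (a₁ j) f₀ f₁ x = (p j x : Trop) :=
    fun j hj x => by rw [hb₀ j hj, hb₁ j hj]; exact linComp_coe h₀ h₁ _ _ x
  have hpB : ∀ j x, |p j x - h x| ≤ max |b₀ j| |b₁ j| := fun j x =>
    abs_sup_add_sub_sup_le _ _ _ _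
  have hroot : ∀ j ∈ Finset.Icc 1 q,
      (fun r => rootCounting r (linComp (a₀ j) (a₁ j) f₀ f₁) - (shiftedMean h r 0 - h 0))
        =o[l] fun r => shiftedMean h r 0 - h 0 := fun j hj =>
    ((rootCounting_sub_isLittleO (hp j) hh.continuous (hpP j hj) (hpB j) hl htop').add
      (hconst (h 0))).congr_left fun r => by ring
  have hm1 : 1 ∈ Finset.Icc 1 q := Finset.mem_Icc.2 ⟨le_rfl, by omega⟩
  have hm2 : 2 ∈ Finset.Icc 1 q := Finset.mem_Icc.2 ⟨by omega, hq⟩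
  have hcas : (fun r => rootCounting r (casorati c
      ![linComp (a₀ 1) (a₁ 1) f₀ f₁, linComp (a₀ 2) (a₁ 2) f₀ f₁]) -
        2 * (shiftedMean h r 0 - h 0)) =o[l] fun r => shiftedMean h r 0 - h 0 := by
    have hent : IsRealEntire fun x =>
        max (p 1 x + p 2 (x + c)) (p 1 (x + c) + p 2 x) :=
      ((hp 1).add ((hp 2).comp_add_right c)).sup (((hp 1).comp_add_right c).add (hp 2))
    have hhc : Continuous h := hh.continuous
    have hcont : Continuous fun x => h x + h (x + c) := by fun_prop
    have h1 := rootCounting_sub_isLittleO hent hcont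
      (casorati_two_coe (hpP 1 hm1) (hpP 2 hm2) c) (abs_casorati_sub_le (hpB 1) (hpB 2) c) hl htop'
    refine ((h1.add (hshift c)).add (hconst (2 * h 0))).congr_left fun r => ?_
    have h2 : shiftedMean (fun x => h x + h (x + c)) r 0 =
        shiftedMean h r 0 + shiftedMean h r c := by
      have := integral_add (integrable_shifted hhc r 0) (integrable_shifted hhc r c)
      simpa [shiftedMean] using this
    rw [h2]
    ring
  refine ⟨E, hE, hE0, ?_, ?_⟩
  -- The `q` root terms contribute `q T_f` and the Casoratian removes `2 T_f`.
  · refine (hcas.sub (IsLittleO.sum hroot)).congr_left fun r => ?_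
    rw [Finset.sum_apply, Finset.sum_sub_distrib, Finset.sum_const, Nat.card_Icc, nsmul_eq_mul]
    push_cast
    ring
  · have hsub : ∀ j ∈ Finset.Icc 3 q, j ∈ Finset.Icc 1 q := fun j hj => by
      rw [Finset.mem_Icc] at hj ⊢; omega
    refine (IsLittleO.sum fun j hj => hroot j (hsub j hj)).neg_left.congr_left fun r => ?_
    rw [Finset.sum_apply, Finset.sum_sub_distrib, Finset.sum_const, Nat.card_Icc, nsmul_eq_mul,
      show q + 1 - 3 = q - 2 by omega, Nat.cast_sub hq]
    push_cast
    ring
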